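/- **Setting.** Let $\mathcal Y$ be a countable set; all densities on $\mathcal Y$ are probability mass functions, and for a density $q$ write $E_q,\operatorname{Var}_q$ for expectation and variance when $y_1\sim q$. A *statistical model* of dimension $d\ge 0$ is a family $\mathcal M=\{f(\cdot\mid\xi):\xi\in\Xi\}$ of densities on $\mathcal Y$ with $\Xi\subseteq\mathbb R^d$; for $y^{(n)}\in\mathcal Y^n$ let $f^n(y^{(n)}\mid\xi)=\prod_{i=1}^n f(y_i\mid\xi)$. Put $\ell(y\mid\xi)=\log f(y\mid\xi)$, with gradient $s(y\mid\xi)$ and Hessian $H(y\mid\xi)$ in $\xi$; let $K_q(\xi)=E_q\log\{q(y_1)/f(y_1\mid\xi)\}\in[0,\infty]$ be the Kullback–Leibler divergence, and $K^\star=\inf_{\xi\in\Xi}K_q(\xi)$. *Regular model.* A nonsingleton model ($d\ge1$) is regular with respect to a strictly positive density $q$ if: 1. $\Xi$ is open; 2. $f(\cdot\mid\xi)>0$ for all $\xi\in\Xi$; 3. there is a unique $\xi^\star\in\Xi$ with $K_q(\xi^\star)=K^\star$; 4. $\operatorname{Var}_q\log\{q(y_1)/f(y_1\mid\xi^\star)\}<\infty$;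 5. $\ell(y\mid\cdot)$ is twice continuously differentiable on $\Xi$ for every $y\in\mathcal Y$; 6. $E_q|\ell(y_1\mid\xi^\star)|<\infty$ and $E_q\|s(y_1\mid\xi^\star)\|^2<\infty$; 7. there are a ball $B\subseteq\Xi$ centred at $\xi^\star$ and $c:\mathcal Y\to[0,\infty)$ with $E_q c(y_1)<\infty$ and $\sup_{\xi\in B}\|H(y\mid\xi)\|\le c(y)$ for all $y$; 8. for all $n\ge1$, $y^{(n)}\in\mathcal Y^n$ and $\lambda\in\mathbb R$ the set $\{\xi\in\Xi: n^{-1}\sum_{i=1}^n\ell(y_i\mid\xi)>\lambda\}$ is connected (possibly empty); 9. the matrix $E_q H(y_1\mid\xi^\star)$ is negative definite (equivalently, $K_q$ has a positive definite Hessian at $\xi^\star$). A singleton model ($d=0$, $\Xi=\{\xi^\star\}$) is regular with respect to $q$ if 2 and 4 hold and $K^\star=K_q(\xi^\star)<\infty$. *Priors.* A *local prior* on $\Xi$ is a strictly positive continuous probability density $p$ on $\Xi$ (for a singleton model, the trivial one). A *regular generalized moment prior* is a probability density $p^M=gp/\int_\Xi gp$ on $\Xi$, where $p$ is a local prior, $g:\Xi\to[0,\infty)$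 is $C^\infty$ with $0<\int_\Xi gp<\infty$, and at every $\xi\in\Xi$ the *order* of $p^M$ at $\xi$, i.e. the least integer $h\ge0$ with $g^{(2h)}(\xi)\ne0$ (where $g^{(k)}$ is the $k$-th derivative, $g^{(0)}=g$), is finite. The marginal likelihood of $\mathcal M$ under a prior $p$ is $m(y^{(n)})=\int_\Xi f^n(y^{(n)}\mid\xi)p(\xi)\,d\xi$ (for a singleton model, $f^n(y^{(n)}\mid\xi^\star)$). **Statement.** Let $\mathcal M_0\subset\mathcal M_1$ be nested models of dimensions $d_0<d_1$, both regular with respect to every distribution in $\mathcal M_1$. Equip $\mathcal M_1$ with a regular generalized moment prior $p_1^M\propto g p_1$ whose order equals $h$ at every $\xi\in\Xi_1$ with $f_1(\cdot\mid\xi)\in\mathcal M_0$, and $\mathcal M_0$ with a local prior. Let $y_1,y_2,\dots$ be i.i.d. with density $q$, let $\mathrm{BF}_{10}(y^{(n)})=m_1(y^{(n)})/m_0(y^{(n)})$ be the Bayes factor, $\mathrm{BF}_{01}=1/\mathrm{BF}_{10}$, and let $K^\star=\inf_{\xi\in\Xi_0}K_q(\xi)$ be the Kullback–Leibler divergence from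 $q$ to $\mathcal M_0$. As $n\to\infty$: (i) if $q\in\mathcal M_1\setminus\mathcal M_0$, then $0<K^\star<\infty$ and $$\mathrm{BF}_{01}(y^{(n)})=\exp\{-nK^\star+O_p(n^{1/2})\};$$ (ii) if $q\in\mathcal M_0$, then $$\mathrm{BF}_{10}(y^{(n)})=\exp\Bigl\{-\Bigl(\tfrac{d_1-d_0}{2}+h\Bigr)\log n+O_p(1)\Bigr\},$$ so the learning rate under the null is accelerated by $n^{-h}$: if $\mathrm{BF}^{L}_{10}$ denotes the Bayes factor with the local prior $p_1$ in place of $p_1^M$, then $\mathrm{BF}_{10}(y^{(n)})=\mathrm{BF}^{L}_{10}(y^{(n)})\,n^{-h}e^{O_p(1)}$. -/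

import Mathlib

open MeasureTheory ProbabilityTheory Filter
open scoped ENNReal

noncomputable section

/-- A parametric statistical model for i.i.d. discrete data in `Y`: a parameter space `Ξ ⊆ ℝᵈ` and,
for each parameter value `ξ`, the (one-observation) sampling density `f(· | ξ)`, a probability mass
function on `Y`. Only the values of `f` on `Ξ` matter. -/
structure StatModel (Y : Type*) (d : ℕ) where
  Ξ : Set (EuclideanSpace ℝ (Fin d))
  f : EuclideanSpace ℝ (Fin d) → PMF Y

namespace StatModel

variable {Y : Type*} {d : ℕ}

/-- The set of sampling distributions `{f(· | ξ) : ξ ∈ Ξ}`. -/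
def dists (M : StatModel Y d) : Set (PMF Y) := M.f '' M.Ξ

/-- The likelihood `fⁿ(y | ξ) = ∏ᵢ f(yᵢ | ξ)` of a sample of size `n`. -/
def likelihood (M : StatModel Y d) {n : ℕ} (y : Fin n → Y) (ξ : EuclideanSpace ℝ (Fin d)) : ℝ :=
  ∏ i, (M.f ξ (y i)).toReal

/-- The unit log-likelihood `ℓ(y | ξ) = log f(y | ξ)`. -/
def logLik (M : StatModel Y d) (y : Y) (ξ : EuclideanSpace ℝ (Fin d)) : ℝ :=
  Real.log (M.f ξ y).toReal

/-- The score `s(y | ξ)`: gradient of the unit log-likelihood with respect to the parameter. -/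
def score (M : StatModel Y d) (y : Y) (ξ : EuclideanSpace ℝ (Fin d)) : EuclideanSpace ℝ (Fin d) :=
  gradient (M.logLik y) ξ

/-- The Hessian `H(y | ξ)` of the unit log-likelihood, as a bilinear form. -/
def hessian (M : StatModel Y d) (y : Y) (ξ : EuclideanSpace ℝ (Fin d)) :
    EuclideanSpace ℝ (Fin d) →L[ℝ] EuclideanSpace ℝ (Fin d) →L[ℝ] ℝ :=
  fderiv ℝ (fderiv ℝ (M.logLik y)) ξ

/-- The average log-likelihood of a sample. -/
def avgLogLik (M : StatModel Y d) {n : ℕ} (y : Fin n → Y) (ξ : EuclideanSpace ℝ (Fin d)) : ℝ :=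
  (∑ i, M.logLik (y i) ξ) / n

/-- The Kullback-Leibler divergence `K_q(ξ) = E_q log {q(y₁) / f(y₁ | ξ)}`, in `[0, ∞]`. -/
def kl [MeasurableSpace Y] (M : StatModel Y d) (q : PMF Y) (ξ : EuclideanSpace ℝ (Fin d)) : ℝ≥0∞ :=
  InformationTheory.klDiv q.toMeasure (M.f ξ).toMeasure

/-- The Kullback-Leibler divergence `K⋆ = inf_{ξ ∈ Ξ} K_q(ξ)` from `q` to the model. -/
def klStar [MeasurableSpace Y] (M : StatModel Y d) (q : PMF Y) : ℝ≥0∞ :=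
  ⨅ ξ ∈ M.Ξ, M.kl q ξ

/-- `ξ` is a Kullback-Leibler projection of `q` on the model. -/
def IsKLProj [MeasurableSpace Y] (M : StatModel Y d) (q : PMF Y)
    (ξ : EuclideanSpace ℝ (Fin d)) : Prop :=
  ξ ∈ M.Ξ ∧ M.kl q ξ = M.klStar q

/-- The requirements of regularity of a nonsingleton, possibly misspecified, model with respect to
the strictly positive sampling density `q`. Since the projection is unique, the clauses quantified
over `ξ` with `M.IsKLProj q ξ` are about the single point `ξ⋆`. -/
structure IsRegularNonsingleton [MeasurableSpace Y] (M : StatModel Y d) (q : PMF Y) : Prop where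
  sampling_pos : ∀ y, 0 < q y
  isOpen : IsOpen M.Ξ
  pos : ∀ ξ ∈ M.Ξ, ∀ y, 0 < M.f ξ y
  existsUnique_proj : ∃! ξ, M.IsKLProj q ξ
  /-- `log {q(y₁) / f(y₁ | ξ⋆)}` has finite variance under `q`. -/
  variance_finite : ∀ ξ, M.IsKLProj q ξ →
    MemLp (fun y => Real.log ((q y).toReal / (M.f ξ y).toReal)) 2 q.toMeasure
  contDiffOn : ∀ y, ContDiffOn ℝ 2 (M.logLik y) M.Ξ
  integrable_logLik : ∀ ξ, M.IsKLProj q ξ → Integrable (fun y => M.logLik y ξ) q.toMeasure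
  memLp_score : ∀ ξ, M.IsKLProj q ξ → MemLp (fun y => M.score y ξ) 2 q.toMeasure
  /-- The Hessian is dominated, near `ξ⋆`, by a `q`-integrable function of the observation. -/
  hessian_dominated : ∀ ξ, M.IsKLProj q ξ → ∃ r : ℝ, 0 < r ∧ Metric.ball ξ r ⊆ M.Ξ ∧
    ∃ c : Y → ℝ, Integrable c q.toMeasure ∧ ∀ y, ∀ ξ' ∈ Metric.ball ξ r, ‖M.hessian y ξ'‖ ≤ c y
  /-- `E_q H(y₁ | ξ⋆)` is negative definite, that is, `K_q` has a positive definite Hessian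
  matrix at `ξ⋆`. -/
  hessian_negDef : ∀ ξ, M.IsKLProj q ξ → ∀ v : EuclideanSpace ℝ (Fin d), v ≠ 0 →
    ∫ y, M.hessian y ξ v v ∂q.toMeasure < 0
  /-- All upper level sets of the average log-likelihood are connected (possibly empty). -/
  levelSets : ∀ n : ℕ, 0 < n → ∀ (y : Fin n → Y) (t : ℝ),
    IsPreconnected {ξ ∈ M.Ξ | t < M.avgLogLik y ξ}

/-- The requirements of regularity of a singleton model with respect to `q`. -/
structure IsRegularSingleton [MeasurableSpace Y] (M : StatModel Y d) (q : PMF Y) : Prop where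
  sampling_pos : ∀ y, 0 < q y
  exists_eq_singleton : ∃ ξ, M.Ξ = {ξ}
  pos : ∀ ξ ∈ M.Ξ, ∀ y, 0 < M.f ξ y
  kl_finite : M.klStar q ≠ ∞
  variance_finite : ∀ ξ ∈ M.Ξ,
    MemLp (fun y => Real.log ((q y).toReal / (M.f ξ y).toReal)) 2 q.toMeasure

/-- A model is regular with respect to `q`. Singleton models are those of dimension `0`: the only
nonempty parameter space in `ℝ⁰` is a point, while a nonempty open subset of `ℝᵈ` with `0 < d` is
never a point. -/
def IsRegular [MeasurableSpace Y] (M : StatModel Y d) (q : PMF Y) : Prop :=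
  (d = 0 ∧ M.IsRegularSingleton q) ∨ (0 < d ∧ M.IsRegularNonsingleton q)

/-- A local prior: a strictly positive continuous probability density on the parameter space.
For a singleton model (`d = 0`, Lebesgue measure on `ℝ⁰` being the unit mass at the point) the only
one is the trivial one, equal to `1`. -/
structure IsLocalPrior (M : StatModel Y d) (p : EuclideanSpace ℝ (Fin d) → ℝ) : Prop where
  pos : ∀ ξ ∈ M.Ξ, 0 < p ξ
  continuousOn : ContinuousOn p M.Ξ
  integrableOn : IntegrableOn p M.Ξ
  integral_eq_one : ∫ ξ in M.Ξ, p ξ = 1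

/-- `h` is the order at `ξ` of the moment function `g`: the least natural number `h` such that
the derivative `g⁽²ʰ⁾(ξ)` is not zero. -/
def HasMomentOrder (g : EuclideanSpace ℝ (Fin d) → ℝ) (ξ : EuclideanSpace ℝ (Fin d)) (h : ℕ) :
    Prop :=
  IsLeast {k : ℕ | iteratedFDeriv ℝ (2 * k) g ξ ≠ 0} h

/-- The generalized moment prior proportional to `g p`, as a probability density on `Ξ`. -/
def momentPrior (M : StatModel Y d) (g p : EuclideanSpace ℝ (Fin d) → ℝ)
    (ξ : EuclideanSpace ℝ (Fin d)) : ℝ :=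
  g ξ * p ξ / ∫ ξ' in M.Ξ, g ξ' * p ξ'

/-- The generalized moment prior with moment function `g` and local prior `p` is regular. -/
structure IsRegularMomentPrior (M : StatModel Y d) (g p : EuclideanSpace ℝ (Fin d) → ℝ) :
    Prop where
  isLocalPrior : M.IsLocalPrior p
  contDiffOn : ContDiffOn ℝ ((⊤ : ℕ∞) : WithTop ℕ∞) g M.Ξ
  nonneg : ∀ ξ ∈ M.Ξ, 0 ≤ g ξ
  exists_order : ∀ ξ ∈ M.Ξ, ∃ h, HasMomentOrder g ξ h
  integrableOn : IntegrableOn (fun ξ => g ξ * p ξ) M.Ξ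
  integral_pos : 0 < ∫ ξ in M.Ξ, g ξ * p ξ

/-- The marginal likelihood of a sample under the prior density `p`. -/
def marginal (M : StatModel Y d) (p : EuclideanSpace ℝ (Fin d) → ℝ) {n : ℕ} (y : Fin n → Y) : ℝ :=
  ∫ ξ in M.Ξ, M.likelihood y ξ * p ξ

/-- The set of parameter values of `M₁` that correspond to distributions in `M₀`. -/
def nullSubspace {d₀ d₁ : ℕ} (M₀ : StatModel Y d₀) (M₁ : StatModel Y d₁) :
    Set (EuclideanSpace ℝ (Fin d₁)) :=
  {ξ ∈ M₁.Ξ | M₁.f ξ ∈ M₀.dists}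

/-- The Bayes factor in favour of `M₁` with prior `p₁`, against `M₀` with prior `p₀`. -/
def bayesFactor {d₀ d₁ : ℕ} (M₁ : StatModel Y d₁) (p₁ : EuclideanSpace ℝ (Fin d₁) → ℝ)
    (M₀ : StatModel Y d₀) (p₀ : EuclideanSpace ℝ (Fin d₀) → ℝ) {n : ℕ} (y : Fin n → Y) : ℝ :=
  M₁.marginal p₁ y / M₀.marginal p₀ y

end StatModel

/-- `Rₙ = O_p(rₙ)`: for every `ε > 0` there is `C` such that, for all large `n`,
`|Rₙ| > C rₙ` has probability at most `ε`. -/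
def IsBigOInProb {Ω : Type*} [MeasurableSpace Ω] (P : Measure Ω) (R : ℕ → Ω → ℝ) (r : ℕ → ℝ) :
    Prop :=
  ∀ ε : ℝ, 0 < ε → ∃ C : ℝ, 0 < C ∧
    ∀ᶠ n in atTop, P {ω | C * r n < |R n ω|} ≤ ENNReal.ofReal ε

end

/-!
Everything reduces to one fact about a regular model `M` of dimension `d`, a sampling density `q`
with Kullback-Leibler projection `ξ⋆`, and a prior density which near `ξ⋆` behaves like a
nonnegative form of degree `2 h`: up to a factor `exp (O_p(1))`, the marginal likelihood is the
likelihood at `ξ⋆` times `n ^ (-(d / 2 + h))`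
(`StatModel.isBigOInProb_log_marginal`). A local prior has `h = 0`.

The Laplace approximation is proved by two-sided bounds, with the scale `s = √n`.

* Let `F` be the log-likelihood of the sample. On a small fixed ball around `ξ⋆`, with probability
  close to one, `F (ξ⋆ + u) - F ξ⋆` lies between two functions `± C √n ‖u‖ - const * n ‖u‖²`
  (`exists_quadratic_bounds`). The linear term is `O_p(√n)` because the expected score vanishes at
  the minimum `ξ⋆` of the divergence (`StatModel.integral_score_eq_zero`), by Chebyshev's
  inequality.
  The quadratic term comes from the law of large numbers for the Hessian at `ξ⋆` and for its modulus
  of continuity, whose expectation is small on small balls (`exists_hessian_modulus`).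
* Away from `ξ⋆` there is no bound on individual terms. Instead, `F` is at most `F ξ⋆ - ε n` on
  a small sphere; the upper level set above this value is connected and contains `ξ⋆`, so the same
  bound holds everywhere outside that sphere (`le_of_isPreconnected_levelSet`), and that region is negligible.
* With these bounds the substitution `u = w / s` gives the power `s ^ (-(d + 2 h))` from above
  (`exists_laplace_upper_bound`) and, by integrating over one ball of radius of order `1 / s`, from
  below (`exists_laplace_lower_bound`).

A moment function `g ≥ 0` of order `h` does behave like a form of degree `2 h`
(`hasExactDegree_of_order`): the order only concerns derivatives of even degree, but the first
nonvanishing derivative of a nonnegative function is nonnegative on the diagonal, hence of even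
degree, and it is positive in some direction by polarization. The latter uses the symmetry of the
iterated derivatives of smooth functions (`ContDiffOn.iteratedFDeriv_comp_perm`).

The Bayes factor is a ratio of two such marginal likelihoods. If `q` belongs to the smaller model,
both projections have density `q`, the likelihood terms cancel, and the powers of `n` remain. If
not, they leave the sum of `log (q / f₀(· | ξ⋆))`, which is `n K⋆ + O_p(√n)`; the logarithmic terms
are of lower order, and `K⋆ > 0` since the infimum is attained at a density different from `q`.
-/

/-! ### Taylor's formula and symmetry of iterated derivatives -/

open Topology in
/-- **Taylor's formula with Lagrange remainder along a segment.** -/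
theorem exists_taylor_lagrange_segment {E : Type*} [NormedAddCommGroup E] [NormedSpace ℝ E]
    {f : E → ℝ} {x u : E} (m : ℕ)
    (hf : ∀ t ∈ Set.Icc (0 : ℝ) 1, ContDiffAt ℝ m f (x + t • u)) :
    ∃ θ ∈ Set.Icc (0 : ℝ) 1, f (x + u) =
      ∑ k ∈ Finset.range m, ((k.factorial : ℝ)⁻¹ * iteratedFDeriv ℝ k f x (fun _ => u)) +
        (m.factorial : ℝ)⁻¹ * iteratedFDeriv ℝ m f (x + θ • u) (fun _ => u) := by
  rcases m with _ | n
  · exact ⟨1, by simp, by simp⟩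
  have hline : ∀ t : ℝ, ContinuousAt (fun t : ℝ => x + t • u) t := fun t => by fun_prop
  have hcd : ∀ t ∈ Set.Icc (0 : ℝ) 1, ContDiffAt ℝ ((n + 1 : ℕ) : WithTop ℕ∞)
      (fun s : ℝ => f (x + s • u)) t := fun t ht =>
    (hf t ht).comp t (f := fun s : ℝ => x + s • u) (by fun_prop)
  -- the derivatives of the restriction to the line, at all points of the closed segment
  have hder : ∀ k ≤ n + 1, ∀ t ∈ Set.Icc (0 : ℝ) 1,
      iteratedDeriv k (fun s : ℝ => f (x + s • u)) t =
        iteratedFDeriv ℝ k f (x + t • u) (fun _ => u) := by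
    intro k hk t ht
    have hev : ∀ᶠ s in 𝓝 t, ContDiffAt ℝ ((n + 1 : ℕ) : WithTop ℕ∞) f (x + s • u) :=
      (hline t).eventually ((hf t ht).eventually (by simp))
    have key : ∀ k ≤ n + 1, ∀ᶠ t' in 𝓝 t,
        iteratedDeriv k (fun s : ℝ => f (x + s • u)) t' =
          iteratedFDeriv ℝ k f (x + t' • u) (fun _ => u) := by
      intro k
      induction k with
      | zero => intro _; simp
      | succ k ih =>
        intro hk
        filter_upwards [(ih (by omega)).eventually_nhds, hev] with t' ht' hc
        rw [iteratedDeriv_succ, EventuallyEq.deriv_eq ht', ContDiffAt.deriv_fderiv_add_smul]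
        exact hc.of_le (by exact_mod_cast hk)
    exact (key k hk).self_of_nhds
  have hcdOn : ContDiffOn ℝ ((n : WithTop ℕ∞) + 1) (fun s : ℝ => f (x + s • u))
      (Set.uIcc (0 : ℝ) 1) := by
    rw [Set.uIcc_of_le zero_le_one]
    exact fun t ht => by exact_mod_cast (hcd t ht).contDiffWithinAt
  obtain ⟨θ, hθ, h⟩ := taylor_mean_remainder_lagrange_iteratedDeriv zero_ne_one hcdOn
  rw [Set.uIoo_of_le zero_le_one] at hθ
  have hθ' := Set.Ioo_subset_Icc_self hθ
  refine ⟨θ, hθ', ?_⟩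
  rw [hder _ le_rfl θ hθ', taylor_within_apply] at h
  simp only [one_smul, sub_zero, one_pow, mul_one, smul_eq_mul] at h
  rw [sub_eq_iff_eq_add'] at h
  rw [h]
  congr 1
  · refine Finset.sum_congr rfl fun k hk => ?_
    have hk' : k ≤ n + 1 := (Finset.mem_range.1 hk).le
    rw [iteratedDerivWithin_eq_iteratedFDerivWithin, iteratedFDerivWithin_eq_iteratedFDeriv
      (uniqueDiffOn_uIcc zero_ne_one) _ (by simp), ← iteratedDeriv_eq_iteratedFDeriv,
      hder k hk' 0 (by simp)]
    · simp
    · exact (hcd 0 (by simp)).of_le (by exact_mod_cast hk')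
  · rw [div_eq_inv_mul]

section Symmetry

variable {E F : Type*} [NormedAddCommGroup E] [NormedSpace ℝ E]
  [NormedAddCommGroup F] [NormedSpace ℝ F]

/-- The iterated derivatives of a smooth function on an open set are symmetric. Invariance is
checked on adjacent transpositions: one that fixes the first argument comes from the symmetry of the
derivative of lower order, and the remaining one from the symmetry of second derivatives. -/
theorem ContDiffOn.iteratedFDeriv_comp_perm {f : E → F} {s : Set E} (hs : IsOpen s)
    (hf : ContDiffOn ℝ ((⊤ : ℕ∞) : WithTop ℕ∞) f s) (n : ℕ) :
    ∀ x ∈ s, ∀ (v : Fin n → E) (σ : Equiv.Perm (Fin n)),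
      iteratedFDeriv ℝ n f x (v ∘ σ) = iteratedFDeriv ℝ n f x v := by
  have hdiff : ∀ (k : ℕ), ∀ x ∈ s, ContDiffAt ℝ ((2 : ℕ) : WithTop ℕ∞) (iteratedFDeriv ℝ k f) x :=
    fun k x hx => (hf.contDiffAt (hs.mem_nhds hx)).iteratedFDeriv_right (by
      rw [← Nat.cast_add]
      exact WithTop.coe_le_coe.2 le_top)
  have hd : ∀ (k : ℕ), ∀ x ∈ s, DifferentiableAt ℝ (iteratedFDeriv ℝ k f) x :=
    fun k x hx => (hdiff k x hx).differentiableAt (by simp)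
  induction n with
  | zero =>
    intro x hx v σ
    rw [Subsingleton.elim (v ∘ σ) v]
  | succ n ih =>
    intro x hx v σ
    have hσ : σ ∈ Submonoid.closure
        (Set.range fun i : Fin n => Equiv.swap i.castSucc i.succ) := by
      rw [Equiv.Perm.mclosure_swap_castSucc_succ]; trivial
    induction hσ using Submonoid.closure_induction generalizing v with
    | one => simp
    | mul σ τ _ _ h₁ h₂ =>
      rw [Equiv.Perm.coe_mul, ← Function.comp_assoc, h₂, h₁]
    | mem σ hσ =>
      obtain ⟨i, rfl⟩ := hσ
      rcases n with _ | n
      · exact i.elim0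
      refine Fin.cases ?_ (fun j => ?_) i
      · have key : ∀ w : Fin (n + 2) → E, iteratedFDeriv ℝ (n + 2) f x w =
            fderiv ℝ (fderiv ℝ (iteratedFDeriv ℝ n f)) x (w 0) (w 1)
              (Fin.tail (Fin.tail w)) := by
          intro w
          rw [(hd (n + 1) x hx).iteratedFDeriv_succ_apply_left']
          have hEq : (fun z => iteratedFDeriv ℝ (n + 1) f z (Fin.tail w)) =
              fun z => fderiv ℝ (iteratedFDeriv ℝ n f) z (w 1) (Fin.tail (Fin.tail w)) := by
            funext z
            rw [iteratedFDeriv_succ_apply_left]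
            rfl
          have h1 : DifferentiableAt ℝ (fderiv ℝ (iteratedFDeriv ℝ n f)) x :=
            ((hdiff n x hx).fderiv_right (m := 1) (by norm_num)).differentiableAt (by simp)
          have h2 : DifferentiableAt ℝ (fun z => fderiv ℝ (iteratedFDeriv ℝ n f) z (w 1)) x :=
            h1.clm_apply (differentiableAt_const _)
          rw [hEq, fderiv_continuousMultilinear_apply_const_apply h2,
            fderiv_clm_apply h1 (differentiableAt_const _)]
          simp
        have hsymm : IsSymmSndFDerivAt ℝ (iteratedFDeriv ℝ n f) x :=
          (hdiff n x hx).isSymmSndFDerivAt (by simp)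
        rw [key, key, hsymm.eq]
        have h0 : (v ∘ Equiv.swap (Fin.castSucc (0 : Fin (n + 1))) (Fin.succ 0)) 0 = v 1 := by
          simp
        have h1 : (v ∘ Equiv.swap (Fin.castSucc (0 : Fin (n + 1))) (Fin.succ 0)) 1 = v 0 := by
          simp
        have ht : Fin.tail (Fin.tail
            (v ∘ Equiv.swap (Fin.castSucc (0 : Fin (n + 1))) (Fin.succ 0))) =
            Fin.tail (Fin.tail v) := by
          funext k
          simp only [Fin.tail, Function.comp_apply]
          rw [Equiv.swap_apply_of_ne_of_ne]
          · simp [Fin.ext_iff]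
          · simp [Fin.ext_iff]
        rw [h0, h1, ht]
      · rw [(hd (n + 1) x hx).iteratedFDeriv_succ_apply_left',
          (hd (n + 1) x hx).iteratedFDeriv_succ_apply_left']
        have h0 : (v ∘ Equiv.swap j.succ.castSucc j.succ.succ) 0 = v 0 := by
          simp only [Function.comp_apply]
          rw [Equiv.swap_apply_of_ne_of_ne]
          · simp [Fin.ext_iff]
          · simp [Fin.ext_iff]
        have ht : Fin.tail (v ∘ Equiv.swap j.succ.castSucc j.succ.succ) =
            Fin.tail v ∘ Equiv.swap j.castSucc j.succ := by
          funext k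
          simp only [Fin.tail, Function.comp_apply]
          congr 1
          rw [← Fin.succ_castSucc, ← (Fin.succ_injective _).swap_apply]
        rw [h0, ht]
        have hev : (fun z => iteratedFDeriv ℝ (n + 1) f z
            (Fin.tail v ∘ Equiv.swap j.castSucc j.succ)) =ᶠ[nhds x]
            fun z => iteratedFDeriv ℝ (n + 1) f z (Fin.tail v) := by
          filter_upwards [hs.mem_nhds hx] with z hz
          exact ih z hz _ _
        rw [hev.fderiv_eq]

/-- Polarization: an iterated derivative that vanishes on the diagonal vanishes. -/
theorem ContDiffOn.iteratedFDeriv_eq_zero_of_diag {f : E → F} {s : Set E} (hs : IsOpen s)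
    (hf : ContDiffOn ℝ ((⊤ : ℕ∞) : WithTop ℕ∞) f s) {n : ℕ} {x : E} (hx : x ∈ s)
    (h : ∀ v : E, iteratedFDeriv ℝ n f x (fun _ => v) = 0) : iteratedFDeriv ℝ n f x = 0 := by
  ext v
  have h1 := (iteratedFDeriv ℝ n f x).iteratedFDeriv_comp_diagonal 0 v
  have h2 : ∀ σ : Equiv.Perm (Fin n), iteratedFDeriv ℝ n f x (fun i => v (σ i)) =
      iteratedFDeriv ℝ n f x v := fun σ => hf.iteratedFDeriv_comp_perm hs n x hx v σ
  simp only [h, h2, Finset.sum_const, Finset.card_univ, Fintype.card_perm, Fintype.card_fin] at h1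
  have h3 : iteratedFDeriv ℝ n (fun _ : E => (0 : F)) 0 v = 0 := by
    simp
  rw [h3, ← Nat.cast_smul_eq_nsmul ℝ] at h1
  have h4 : ((n.factorial : ℕ) : ℝ) ≠ 0 := by positivity
  simpa [h4] using h1.symm

end Symmetry

/-! ### Local behaviour of a moment function -/

/-- `π` behaves near `x` like a nonnegative form of degree `m` which is not identically zero: it is
dominated by `‖u‖ ^ m`, and it is at least of the order of `t ^ m` on the dilates of some ball. -/
structure HasExactDegree {E : Type*} [NormedAddCommGroup E] [NormedSpace ℝ E]
    (π : E → ℝ) (x : E) (m : ℕ) : Prop where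
  upper : ∃ G δ : ℝ, 0 < G ∧ 0 < δ ∧ ∀ u : E, ‖u‖ < δ → π (x + u) ≤ G * ‖u‖ ^ m
  lower : ∃ (v : E) (ρ κ η : ℝ), 0 < ρ ∧ 0 < κ ∧ 0 < η ∧
    ∀ t : ℝ, 0 < t → t < η → ∀ w ∈ Metric.ball v ρ, κ * t ^ m ≤ π (x + t • w)

section ExactDegree

variable {E : Type*} [NormedAddCommGroup E] [NormedSpace ℝ E]

theorem hasExactDegree_one (x : E) : HasExactDegree (fun _ => (1 : ℝ)) x 0 :=
  ⟨⟨1, 1, by simp⟩, ⟨0, 1, 1, 1, by simp⟩⟩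

/-- Multiplication by a function that is continuous and positive at `x` preserves the degree. -/
theorem HasExactDegree.mul {g p : E → ℝ} {x : E} {m : ℕ} (hg : HasExactDegree g x m)
    (hp : ContinuousAt p x) (hpx : 0 < p x) : HasExactDegree (fun ξ => g ξ * p ξ) x m := by
  have hev : ∀ᶠ z in nhds x, p x / 2 < p z ∧ p z < 2 * p x :=
    (hp.eventually (lt_mem_nhds (by linarith))).and (hp.eventually (gt_mem_nhds (by linarith)))
  obtain ⟨r, hr, hball⟩ := Metric.eventually_nhds_iff_ball.1 hev
  constructor
  · obtain ⟨G, δ, hG, hδ, h⟩ := hg.upper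
    refine ⟨G * (2 * p x), min δ r, by positivity, lt_min hδ hr, fun u hu => ?_⟩
    have h1 := h u (hu.trans_le (min_le_left _ _))
    have h2 := hball (x + u) (by simpa using hu.trans_le (min_le_right _ _))
    have h3 : 0 < p (x + u) := by linarith [h2.1]
    calc g (x + u) * p (x + u) ≤ (G * ‖u‖ ^ m) * p (x + u) := by gcongr
      _ ≤ (G * ‖u‖ ^ m) * (2 * p x) := by gcongr; exact h2.2.le
      _ = _ := by ring
  · obtain ⟨v, ρ, κ, η, hρ, hκ, hη, h⟩ := hg.lower
    refine ⟨v, ρ, κ * (p x / 2), min η (r / (‖v‖ + ρ)), hρ, by positivity,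
      lt_min hη (by positivity), fun t ht0 ht w hw => ?_⟩
    have h1 := h t ht0 (ht.trans_le (min_le_left _ _)) w hw
    have hw' : ‖w‖ < ‖v‖ + ρ := by
      have := norm_sub_norm_le w v
      rw [mem_ball_iff_norm] at hw
      linarith
    have h2 := hball (x + t • w) (by
      have h4 : t * (‖v‖ + ρ) < r := by
        rw [← lt_div_iff₀ (by positivity)]; exact ht.trans_le (min_le_right _ _)
      simp only [mem_ball_iff_norm, add_sub_cancel_left, norm_smul, Real.norm_eq_abs,
        abs_of_pos ht0]
      nlinarith)
    calc κ * (p x / 2) * t ^ m = (κ * t ^ m) * (p x / 2) := by ring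
      _ ≤ (κ * t ^ m) * p (x + t • w) := by gcongr; exact h2.1.le
      _ ≤ _ := by
        have h3 : 0 < p (x + t • w) := by linarith [h2.1]
        gcongr

/-- The restriction to the diagonal of the first nonvanishing derivative of a nonnegative function
is nonnegative. -/
theorem iteratedFDeriv_diag_nonneg {g : E → ℝ} {s : Set E} (hs : IsOpen s)
    (hg : ContDiffOn ℝ ((⊤ : ℕ∞) : WithTop ℕ∞) g s) (hnn : ∀ z ∈ s, 0 ≤ g z) {x : E} (hx : x ∈ s)
    {k : ℕ} (hlow : ∀ j < k, iteratedFDeriv ℝ j g x = 0) (v : E) :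
    0 ≤ iteratedFDeriv ℝ k g x (fun _ => v) := by
  by_contra! hneg
  have hk : ∀ z ∈ s, ContDiffAt ℝ k g z := fun z hz =>
    (hg.contDiffAt (hs.mem_nhds hz)).of_le (WithTop.coe_le_coe.2 le_top)
  have hcont : ContinuousAt (fun z => iteratedFDeriv ℝ k g z (fun _ => v)) x :=
    (((hk x hx).iteratedFDeriv_right (m := 0) (by simp)).continuousAt).eval_const _
  obtain ⟨r, hr, hball⟩ := Metric.eventually_nhds_iff_ball.1
    ((hcont.eventually (gt_mem_nhds hneg)).and (hs.mem_nhds hx))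
  -- a point on the half-line from `x` in the direction `v`, so close to `x` that the derivative
  -- is negative on the whole segment
  have hv : 0 < ‖v‖ + 1 := by positivity
  have ht : 0 < r / (‖v‖ + 1) := by positivity
  set t := r / (‖v‖ + 1) with htdef
  have hseg : ∀ θ ∈ Set.Icc (0 : ℝ) 1, x + θ • (t • v) ∈ Metric.ball x r := by
    intro θ hθ
    simp only [mem_ball_iff_norm, add_sub_cancel_left, norm_smul, Real.norm_eq_abs,
      abs_of_pos ht, abs_of_nonneg hθ.1]
    have h1 : t * (‖v‖ + 1) = r := div_mul_cancel₀ _ hv.ne'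
    have h2 : 0 ≤ t * ‖v‖ := by positivity
    nlinarith [hθ.2]
  obtain ⟨θ, hθ, h⟩ := exists_taylor_lagrange_segment (x := x) (u := t • v) k
    (fun θ hθ => hk _ (hball _ (hseg θ hθ)).2)
  have hsum : ∑ j ∈ Finset.range k,
      ((j.factorial : ℝ)⁻¹ * iteratedFDeriv ℝ j g x (fun _ => t • v)) = 0 :=
    Finset.sum_eq_zero fun j hj => by simp [hlow j (Finset.mem_range.1 hj)]
  have hhom : iteratedFDeriv ℝ k g (x + θ • (t • v)) (fun _ => t • v) =
      t ^ k * iteratedFDeriv ℝ k g (x + θ • (t • v)) (fun _ => v) := by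
    rw [ContinuousMultilinearMap.map_smul_univ _ (fun _ => t) (fun _ => v)]; simp
  rw [hsum, zero_add, hhom] at h
  have h0 : x + t • v ∈ s := by
    have := (hball _ (hseg 1 (by simp))).2
    rwa [one_smul] at this
  have h1 : 0 ≤ g (x + t • v) := hnn _ h0
  have h2 := (hball _ (hseg θ hθ)).1
  have h3 : 0 < (k.factorial : ℝ)⁻¹ * t ^ k := by positivity
  rw [h, ← mul_assoc] at h1
  nlinarith

/-- Below twice the order of a nonnegative function, the derivatives of odd degree vanish too: the
first nonvanishing derivative is nonnegative on the diagonal, hence has even degree. -/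
theorem iteratedFDeriv_eq_zero_of_lt_order {g : E → ℝ} {s : Set E} (hs : IsOpen s)
    (hg : ContDiffOn ℝ ((⊤ : ℕ∞) : WithTop ℕ∞) g s) (hnn : ∀ z ∈ s, 0 ≤ g z) {x : E} (hx : x ∈ s)
    {h : ℕ} (hh : IsLeast {k : ℕ | iteratedFDeriv ℝ (2 * k) g x ≠ 0} h) :
    ∀ k < 2 * h, iteratedFDeriv ℝ k g x = 0 := by
  intro k
  induction k using Nat.strong_induction_on with
  | _ k ih =>
    intro hk
    rcases Nat.even_or_odd' k with ⟨j, rfl | rfl⟩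
    · by_contra hne
      have := hh.2 hne
      omega
    · have hlow : ∀ i < 2 * j + 1, iteratedFDeriv ℝ i g x = 0 := fun i hi => ih i hi (by omega)
      refine hg.iteratedFDeriv_eq_zero_of_diag hs hx fun v => le_antisymm ?_
        (iteratedFDeriv_diag_nonneg hs hg hnn hx hlow v)
      have h1 := iteratedFDeriv_diag_nonneg hs hg hnn hx hlow (-v)
      have h2 : iteratedFDeriv ℝ (2 * j + 1) g x (fun _ => -v) =
          - iteratedFDeriv ℝ (2 * j + 1) g x (fun _ => v) := by
        have := ContinuousMultilinearMap.map_smul_univ (iteratedFDeriv ℝ (2 * j + 1) g x)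
          (fun _ => (-1 : ℝ)) (fun _ => v)
        simpa [pow_succ, pow_mul] using this
      linarith

/-- A nonnegative smooth function of order `h` at `x` behaves near `x` like a form of
degree `2 * h`. -/
theorem hasExactDegree_of_order {g : E → ℝ} {s : Set E} (hs : IsOpen s)
    (hg : ContDiffOn ℝ ((⊤ : ℕ∞) : WithTop ℕ∞) g s) (hnn : ∀ z ∈ s, 0 ≤ g z) {x : E} (hx : x ∈ s)
    {h : ℕ} (hh : IsLeast {k : ℕ | iteratedFDeriv ℝ (2 * k) g x ≠ 0} h) :
    HasExactDegree g x (2 * h) := by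
  have hlow := iteratedFDeriv_eq_zero_of_lt_order hs hg hnn hx hh
  set m := 2 * h with hm
  have hk : ∀ z ∈ s, ContDiffAt ℝ m g z := fun z hz =>
    (hg.contDiffAt (hs.mem_nhds hz)).of_le (WithTop.coe_le_coe.2 le_top)
  have hcont : ContinuousAt (iteratedFDeriv ℝ m g) x :=
    ((hk x hx).iteratedFDeriv_right (m := 0) (by simp)).continuousAt
  obtain ⟨r, hr, hball⟩ := Metric.nhds_basis_ball.mem_iff.1 (hs.mem_nhds hx)
  have hexp : ∀ u : E, ‖u‖ < r → ∃ θ ∈ Set.Icc (0 : ℝ) 1, g (x + u) =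
      (m.factorial : ℝ)⁻¹ * iteratedFDeriv ℝ m g (x + θ • u) (fun _ => u) := by
    intro u hu
    obtain ⟨θ, hθ, h⟩ := exists_taylor_lagrange_segment (f := g) (x := x) (u := u) m
      (fun θ hθ => hk _ (hball (by
        simp only [mem_ball_iff_norm, add_sub_cancel_left, norm_smul, Real.norm_eq_abs,
          abs_of_nonneg hθ.1]
        nlinarith [hθ.2, norm_nonneg u])))
    refine ⟨θ, hθ, h.trans ?_⟩
    rw [Finset.sum_eq_zero fun j hj => by simp [hlow j (Finset.mem_range.1 hj)], zero_add]
  have hpos : ∃ v, 0 < iteratedFDeriv ℝ m g x (fun _ => v) := by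
    by_contra! hcon
    exact hh.1 (hg.iteratedFDeriv_eq_zero_of_diag hs hx fun v =>
      le_antisymm (hcon v) (iteratedFDeriv_diag_nonneg hs hg hnn hx hlow v))
  have hseg : ∀ (u : E) (δ : ℝ), ‖u‖ < δ → ∀ θ ∈ Set.Icc (0 : ℝ) 1,
      dist (x + θ • u) x < δ := by
    intro u δ hu θ hθ
    simp only [dist_eq_norm, add_sub_cancel_left, norm_smul, Real.norm_eq_abs, abs_of_nonneg hθ.1]
    nlinarith [hθ.2, norm_nonneg u]
  constructor
  · obtain ⟨δ, hδ, hb⟩ := Metric.eventually_nhds_iff.1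
      (hcont.norm.eventually (gt_mem_nhds (lt_add_one _)))
    refine ⟨(m.factorial : ℝ)⁻¹ * (‖iteratedFDeriv ℝ m g x‖ + 1), min r δ, by positivity,
      lt_min hr hδ, fun u hu => ?_⟩
    obtain ⟨θ, hθ, h⟩ := hexp u (hu.trans_le (min_le_left _ _))
    have h1 := hb (hseg u δ (hu.trans_le (min_le_right _ _)) θ hθ)
    have h2 := (iteratedFDeriv ℝ m g (x + θ • u)).le_opNorm (fun _ => u)
    simp only [Finset.prod_const, Finset.card_univ, Fintype.card_fin] at h2
    rw [h, mul_assoc]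
    gcongr
    calc _ ≤ _ := le_abs_self _
      _ ≤ _ := h2
      _ ≤ _ := by gcongr
  · obtain ⟨v, hv⟩ := hpos
    set T := iteratedFDeriv ℝ m g x (fun _ => v) with hT
    have hc2 : ContinuousAt (fun z : E × E => iteratedFDeriv ℝ m g z.1 (fun _ => z.2)) (x, v) :=
      ContinuousAt.eval (F := E [×m]→L[ℝ] ℝ)
        (ContinuousAt.comp (f := Prod.fst) (x := (x, v)) hcont continuousAt_fst) (by fun_prop)
    obtain ⟨δ, hδ, hb⟩ :=
      Metric.eventually_nhds_iff.1 (hc2.eventually (lt_mem_nhds (half_lt_self hv)))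
    refine ⟨v, δ, (m.factorial : ℝ)⁻¹ * (T / 2), min r δ / (‖v‖ + δ), hδ, by positivity,
      by positivity, fun t ht0 ht w hw => ?_⟩
    have hw' : ‖w‖ < ‖v‖ + δ := by
      have := norm_sub_norm_le w v
      rw [mem_ball_iff_norm] at hw
      linarith
    have htw : ‖t • w‖ < min r δ := by
      rw [lt_div_iff₀ (by positivity)] at ht
      rw [norm_smul, Real.norm_eq_abs, abs_of_pos ht0]
      nlinarith
    obtain ⟨θ, hθ, h⟩ := hexp (t • w) (htw.trans_le (min_le_left _ _))
    have h1 : T / 2 < iteratedFDeriv ℝ m g (x + θ • (t • w)) (fun _ => w) :=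
      hb (y := (x + θ • (t • w), w)) (by
        rw [Prod.dist_eq]
        exact max_lt (hseg _ δ (htw.trans_le (min_le_right _ _)) θ hθ) hw)
    have hhom : iteratedFDeriv ℝ m g (x + θ • (t • w)) (fun _ => t • w) =
        t ^ m * iteratedFDeriv ℝ m g (x + θ • (t • w)) (fun _ => w) := by
      rw [ContinuousMultilinearMap.map_smul_univ _ (fun _ => t) (fun _ => w)]; simp
    rw [h, hhom, mul_assoc, mul_comm (T / 2)]
    gcongr

end ExactDegree

/-! ### Laplace bounds for an integral against a likelihood -/

section Laplace

/-- A function with connected upper level sets which is smaller than `F x - ε` on a sphere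
around `x` is so small everywhere outside that sphere. -/
theorem le_of_isPreconnected_levelSet {E : Type*} [NormedAddCommGroup E] {Ξ : Set E} {F : E → ℝ}
    {x : E} (hx : x ∈ Ξ) {δ ε : ℝ} (hδ : 0 < δ) (hε : 0 < ε)
    (hconn : IsPreconnected {ξ ∈ Ξ | F x - ε < F ξ})
    (hsphere : ∀ ξ ∈ Ξ, ‖ξ - x‖ = δ → F ξ ≤ F x - ε) :
    ∀ ξ ∈ Ξ, δ ≤ ‖ξ - x‖ → F ξ ≤ F x - ε := by
  intro ξ hξ hξδ
  by_contra! hlt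
  have hsub : {ξ ∈ Ξ | F x - ε < F ξ} ⊆ Metric.ball x δ := by
    refine hconn.subset_left_of_subset_union Metric.isOpen_ball
      (Metric.isClosed_closedBall (x := x) (ε := δ)).isOpen_compl ?_ ?_
      ⟨x, ⟨hx, by linarith⟩, by simpa using hδ⟩
    · exact disjoint_compl_right.mono_left Metric.ball_subset_closedBall
    · rintro z ⟨hz, hlt'⟩
      rcases lt_trichotomy ‖z - x‖ δ with h | h | h
      · exact Or.inl (mem_ball_iff_norm.2 h)
      · exact absurd (hsphere z hz h) (not_le.2 hlt')
      · exact Or.inr (by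
          rw [Set.mem_compl_iff, mem_closedBall_iff_norm]; exact not_le.2 h)
  have := hsub ⟨hξ, hlt⟩
  rw [mem_ball_iff_norm] at this
  linarith

variable {E : Type*} [NormedAddCommGroup E] [InnerProductSpace ℝ E] [FiniteDimensional ℝ E]
  [MeasurableSpace E] [BorelSpace E]

theorem integrable_exp_sub_sq_mul_norm_pow (C : ℝ) {a : ℝ} (ha : 0 < a) (m : ℕ) :
    Integrable (fun w : E => Real.exp (C * ‖w‖ - a * ‖w‖ ^ 2) * ‖w‖ ^ m) := by
  have hg : Integrable (fun w : E => Real.exp (-(a / 2) * ‖w‖ ^ 2)) := by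
    have h := (GaussianFourier.integrable_cexp_neg_mul_sq_norm_add (V := E) (b := ((a / 2 : ℝ) : ℂ))
      (by simpa using ha) 0 0).norm
    refine h.congr (ae_of_all _ fun w => ?_)
    simp only [Complex.norm_exp, inner_zero_left]
    congr 1
    rw [zero_mul, add_zero, ← Complex.ofReal_neg, ← Complex.ofReal_pow, ← Complex.ofReal_mul,
      Complex.ofReal_re]
  refine (hg.const_mul (m.factorial * Real.exp ((C + 1) ^ 2 / (2 * a)))).mono'
    (by fun_prop) (ae_of_all _ fun w => ?_)
  have h1 : ‖w‖ ^ m ≤ m.factorial * Real.exp ‖w‖ := by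
    have := Real.pow_div_factorial_le_exp ‖w‖ (norm_nonneg w) m
    rw [div_le_iff₀ (by positivity)] at this
    linarith
  have h2 : C * ‖w‖ - a * ‖w‖ ^ 2 + ‖w‖ ≤ (C + 1) ^ 2 / (2 * a) + -(a / 2) * ‖w‖ ^ 2 := by
    have h3 : (C + 1) ^ 2 / (2 * a) + -(a / 2) * ‖w‖ ^ 2 - (C * ‖w‖ - a * ‖w‖ ^ 2 + ‖w‖) =
        ((C + 1) - a * ‖w‖) ^ 2 / (2 * a) := by
      field_simp
      ring
    have h4 : 0 ≤ ((C + 1) - a * ‖w‖) ^ 2 / (2 * a) := by positivity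
    linarith
  rw [Real.norm_eq_abs, abs_of_nonneg (by positivity)]
  calc Real.exp (C * ‖w‖ - a * ‖w‖ ^ 2) * ‖w‖ ^ m
      ≤ Real.exp (C * ‖w‖ - a * ‖w‖ ^ 2) * (m.factorial * Real.exp ‖w‖) := by gcongr
    _ = m.factorial * Real.exp (C * ‖w‖ - a * ‖w‖ ^ 2 + ‖w‖) := by rw [Real.exp_add]; ring
    _ ≤ m.factorial * Real.exp ((C + 1) ^ 2 / (2 * a) + -(a / 2) * ‖w‖ ^ 2) := by gcongr
    _ = _ := by rw [Real.exp_add]; ring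

/-- Upper half of the Laplace bounds. Near `x` the exponent is dominated by
`C s ‖u‖ - a s² ‖u‖²`, and the substitution `w = s u` produces the factor `s ^ (-(d + m))`; away
from `x` the exponent is at most `-ε s²` by connectedness of the level sets, so that the rest of the
integral is negligible. -/
theorem exists_laplace_upper_bound {Ξ : Set E} (hΞ : MeasurableSet Ξ) {x : E} {r : ℝ} (hr : 0 < r)
    (hball : Metric.ball x r ⊆ Ξ) {π : E → ℝ} (hπ : ∀ ξ ∈ Ξ, 0 ≤ π ξ) (hπi : IntegrableOn π Ξ)
    {m : ℕ} (hdeg : HasExactDegree π x m) {a C : ℝ} (ha : 0 < a) :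
    ∃ K S : ℝ, 0 < K ∧ 0 < S ∧ ∀ s ≥ S, ∀ F : E → ℝ,
      (∀ t, IsPreconnected {ξ ∈ Ξ | t < F ξ}) →
      (∀ u, ‖u‖ < r → F (x + u) - F x ≤ C * s * ‖u‖ - a * s ^ 2 * ‖u‖ ^ 2) →
      IntegrableOn (fun ξ => Real.exp (F ξ - F x) * π ξ) Ξ →
      s ^ (Module.finrank ℝ E + m) * ∫ ξ in Ξ, Real.exp (F ξ - F x) * π ξ ≤ K := by
  obtain ⟨G, δ₀, hG, hδ₀, hup⟩ := hdeg.upper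
  set δ := min r δ₀ / 2 with hδdef
  have hmin : 0 < min r δ₀ := lt_min hr hδ₀
  have hδ : 0 < δ := by positivity
  have hδr : δ < r := by have := min_le_left r δ₀; linarith
  have hδδ₀ : δ < δ₀ := by have := min_le_right r δ₀; linarith
  set Φ : E → ℝ := fun w => Real.exp (C * ‖w‖ - a * ‖w‖ ^ 2) * ‖w‖ ^ m with hΦ
  have hΦi : Integrable Φ := integrable_exp_sub_sq_mul_norm_pow C ha m
  have hΦ0 : ∀ w, 0 ≤ Φ w := fun w => by positivity
  set ε := a * δ ^ 2 / 2 with hε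
  have hεpos : 0 < ε := by positivity
  set D := Module.finrank ℝ E + m with hD
  have hx : x ∈ Ξ := hball (Metric.mem_ball_self hr)
  have htend : Tendsto (fun s : ℝ => s ^ D * Real.exp (-ε * s)) atTop (nhds 0) := by
    simpa using tendsto_rpow_mul_exp_neg_mul_atTop_nhds_zero D ε hεpos
  obtain ⟨S₁, hS₁⟩ := eventually_atTop.1 (htend.eventually (gt_mem_nhds zero_lt_one))
  have hI0 : 0 ≤ ∫ ξ in Ξ, π ξ := setIntegral_nonneg hΞ hπ
  have hJ0 : 0 ≤ ∫ w, Φ w := integral_nonneg hΦ0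
  -- for `s ≥ 2 C / (a δ)` the quadratic term is twice as large as the linear one on the sphere
  refine ⟨G * (∫ w, Φ w) + (∫ ξ in Ξ, π ξ) + 1, max (max S₁ 1) (2 * C / (a * δ)), by positivity,
    by positivity, fun s hs F hconn hquad hint => ?_⟩
  have hs1 : 1 ≤ s := le_trans (le_trans (le_max_right _ _) (le_max_left _ _)) hs
  have hs0 : 0 < s := by linarith
  have hsS₁ : S₁ ≤ s := le_trans (le_trans (le_max_left _ _) (le_max_left _ _)) hs
  have hs2 : 2 * C ≤ s * (a * δ) := by
    rw [← div_le_iff₀ (by positivity)]; exact le_trans (le_max_right _ _) hs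
  -- outside the ball of radius `δ`
  have hsphere : ∀ ξ ∈ Ξ, ‖ξ - x‖ = δ → F ξ ≤ F x - ε * s ^ 2 := by
    intro ξ _ hξδ
    have h := hquad (ξ - x) (by rw [hξδ]; exact hδr)
    rw [add_sub_cancel, hξδ] at h
    have h2 : C * s * δ ≤ ε * s ^ 2 := by
      have : 2 * C * (s * δ) ≤ s * (a * δ) * (s * δ) := by gcongr
      rw [hε]; nlinarith
    have h3 : a * s ^ 2 * δ ^ 2 = 2 * (ε * s ^ 2) := by rw [hε]; ring
    linarith
  have houter : ∀ ξ ∈ Ξ, δ ≤ ‖ξ - x‖ → F ξ ≤ F x - ε * s ^ 2 :=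
    le_of_isPreconnected_levelSet hx hδ (by positivity) (hconn _) hsphere
  set B := Metric.ball x δ with hB
  have hBΞ : B ⊆ Ξ := (Metric.ball_subset_ball hδr.le).trans hball
  have hsplit : ∫ ξ in Ξ, Real.exp (F ξ - F x) * π ξ =
      (∫ ξ in B, Real.exp (F ξ - F x) * π ξ) +
        ∫ ξ in Ξ \ B, Real.exp (F ξ - F x) * π ξ := by
    rw [← setIntegral_union Set.disjoint_sdiff_right (hΞ.diff measurableSet_ball)
      (hint.mono_set hBΞ) (hint.mono_set Set.sdiff_subset), Set.union_sdiff_cancel hBΞ]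
  have hout : ∫ ξ in Ξ \ B, Real.exp (F ξ - F x) * π ξ ≤
      Real.exp (-ε * s) * ∫ ξ in Ξ, π ξ := by
    calc ∫ ξ in Ξ \ B, Real.exp (F ξ - F x) * π ξ
        ≤ ∫ ξ in Ξ \ B, Real.exp (-ε * s) * π ξ := by
          refine setIntegral_mono_on (hint.mono_set Set.sdiff_subset)
            ((hπi.mono_set Set.sdiff_subset).const_mul _) (hΞ.diff measurableSet_ball) ?_
          rintro ξ ⟨hξ, hξB⟩
          have h1 := houter ξ hξ (by
            rw [hB, mem_ball_iff_norm] at hξB; exact not_lt.1 hξB)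
          have h2 := hπ ξ hξ
          have h3 : ε * s ≤ ε * s ^ 2 := by gcongr; nlinarith
          gcongr
          linarith
      _ ≤ ∫ ξ in Ξ, Real.exp (-ε * s) * π ξ := by
          refine setIntegral_mono_set (hπi.const_mul _) ?_ (Set.sdiff_subset.eventuallyLE)
          exact (ae_restrict_iff' hΞ).2 (ae_of_all _ fun ξ hξ =>
            mul_nonneg (Real.exp_pos _).le (hπ ξ hξ))
      _ = _ := integral_const_mul _ _
  -- inside the ball, rescaling by `s`
  have hscale : ∫ ξ, Φ (s • (ξ - x)) = (s ^ Module.finrank ℝ E)⁻¹ * ∫ w, Φ w := by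
    rw [integral_sub_right_eq_self (fun ξ => Φ (s • ξ)) x, Measure.integral_comp_smul,
      abs_of_pos (by positivity), smul_eq_mul]
  have hΦsi : Integrable (fun ξ => Φ (s • (ξ - x))) :=
    (hΦi.comp_smul hs0.ne').comp_sub_right x
  have hin : ∫ ξ in B, Real.exp (F ξ - F x) * π ξ ≤
      G * (s ^ m)⁻¹ * ((s ^ Module.finrank ℝ E)⁻¹ * ∫ w, Φ w) := by
    rw [← hscale, ← integral_const_mul]
    calc ∫ ξ in B, Real.exp (F ξ - F x) * π ξ
        ≤ ∫ ξ in B, G * (s ^ m)⁻¹ * Φ (s • (ξ - x)) := by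
          refine setIntegral_mono_on (hint.mono_set hBΞ) (hΦsi.const_mul _).integrableOn
            measurableSet_ball fun ξ hξ => ?_
          rw [hB, mem_ball_iff_norm] at hξ
          have h1 := hup (ξ - x) (hξ.trans hδδ₀)
          have h2 := hquad (ξ - x) (hξ.trans hδr)
          rw [add_sub_cancel] at h1 h2
          have h3 : G * (s ^ m)⁻¹ * Φ (s • (ξ - x)) =
              Real.exp (C * s * ‖ξ - x‖ - a * s ^ 2 * ‖ξ - x‖ ^ 2) * (G * ‖ξ - x‖ ^ m) := by
            simp only [hΦ, norm_smul, Real.norm_eq_abs, abs_of_pos hs0, mul_pow]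
            field_simp
          rw [h3]
          exact mul_le_mul (Real.exp_le_exp.2 h2) h1
            (hπ ξ (hBΞ (mem_ball_iff_norm.2 hξ))) (Real.exp_pos _).le
      _ ≤ _ := setIntegral_le_integral (hΦsi.const_mul _)
          (ae_of_all _ fun ξ => mul_nonneg (by positivity) (hΦ0 _))
  rw [hsplit, mul_add]
  have e1 : s ^ D * ∫ ξ in B, Real.exp (F ξ - F x) * π ξ ≤ G * ∫ w, Φ w := by
    calc _ ≤ s ^ D * (G * (s ^ m)⁻¹ * ((s ^ Module.finrank ℝ E)⁻¹ * ∫ w, Φ w)) := by gcongr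
      _ = _ := by rw [hD, pow_add]; field_simp
  have e2 : s ^ D * ∫ ξ in Ξ \ B, Real.exp (F ξ - F x) * π ξ ≤ ∫ ξ in Ξ, π ξ := by
    calc _ ≤ s ^ D * (Real.exp (-ε * s) * ∫ ξ in Ξ, π ξ) := by gcongr
      _ = (s ^ D * Real.exp (-ε * s)) * ∫ ξ in Ξ, π ξ := by ring
      _ ≤ 1 * ∫ ξ in Ξ, π ξ := by gcongr; exact (hS₁ s hsS₁).le
      _ = _ := one_mul _
  linarith

/-- Lower half of the Laplace bounds: it is enough to integrate over a ball of radius of order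
`1 / s` on which the exponent is bounded below and `π` is at least of order `s ^ (-m)`. -/
theorem exists_laplace_lower_bound {Ξ : Set E} (hΞ : MeasurableSet Ξ) {x : E} {r : ℝ} (hr : 0 < r)
    (hball : Metric.ball x r ⊆ Ξ) {π : E → ℝ} (hπ : ∀ ξ ∈ Ξ, 0 ≤ π ξ)
    {m : ℕ} (hdeg : HasExactDegree π x m) {A C : ℝ} (hA : 0 < A) (hC : 0 < C) :
    ∃ k S : ℝ, 0 < k ∧ 0 < S ∧ ∀ s ≥ S, ∀ F : E → ℝ,
      (∀ u, ‖u‖ < r → -(C * s * ‖u‖ + A * s ^ 2 * ‖u‖ ^ 2) ≤ F (x + u) - F x) →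
      IntegrableOn (fun ξ => Real.exp (F ξ - F x) * π ξ) Ξ →
      k ≤ s ^ (Module.finrank ℝ E + m) * ∫ ξ in Ξ, Real.exp (F ξ - F x) * π ξ := by
  obtain ⟨v, ρ, κ, η, hρ, hκ, hη, hlow⟩ := hdeg.lower
  set R := ‖v‖ + ρ with hR
  have hRpos : 0 < R := by positivity
  set V := (volume : Measure E).real (Metric.ball 0 1) with hV
  have hVpos : 0 < V :=
    ENNReal.toReal_pos (Metric.measure_ball_pos _ _ one_pos).ne' measure_ball_lt_top.ne
  set c := Real.exp (-(C * R + A * R ^ 2)) with hc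
  refine ⟨c * κ * (ρ ^ Module.finrank ℝ E * V), max (2 / η) (2 * R / r), by positivity,
    by positivity, fun s hs F hquad hint => ?_⟩
  have hs1 : 2 / η ≤ s := le_trans (le_max_left _ _) hs
  have hs2 : 2 * R / r ≤ s := le_trans (le_max_right _ _) hs
  have hs0 : 0 < s := lt_of_lt_of_le (by positivity) hs1
  have hsη : s⁻¹ < η := by
    rw [div_le_iff₀ hη] at hs1
    rw [inv_lt_iff_one_lt_mul₀ hs0]; linarith
  have hsr : R < s * r := by
    rw [div_le_iff₀ hr] at hs2; linarith
  set T := Metric.ball (x + s⁻¹ • v) (ρ / s) with hT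
  -- a point of `T` is `x + s⁻¹ • w` with `w` in the ball of radius `ρ` around `v`
  have hTw : ∀ ξ ∈ T, s • (ξ - x) ∈ Metric.ball v ρ := by
    intro ξ hξ
    rw [hT, mem_ball_iff_norm, lt_div_iff₀ hs0] at hξ
    have h1 : s • (ξ - x) - v = s • (ξ - (x + s⁻¹ • v)) := by
      rw [smul_sub, smul_sub, smul_add, smul_inv_smul₀ hs0.ne']; abel
    rw [mem_ball_iff_norm, h1, norm_smul, Real.norm_eq_abs, abs_of_pos hs0]
    linarith
  have hTn : ∀ ξ ∈ T, s * ‖ξ - x‖ < R := by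
    intro ξ hξ
    have h1 := hTw ξ hξ
    rw [mem_ball_iff_norm] at h1
    have h2 := norm_sub_norm_le (s • (ξ - x)) v
    rw [norm_smul, Real.norm_eq_abs, abs_of_pos hs0] at h2
    linarith
  have hTr : ∀ ξ ∈ T, ‖ξ - x‖ < r := by
    intro ξ hξ
    have := hTn ξ hξ
    by_contra! hcon
    nlinarith
  have hTΞ : T ⊆ Ξ := fun ξ hξ => hball (by rw [mem_ball_iff_norm]; exact hTr ξ hξ)
  have hvol : (volume : Measure E).real T = (ρ / s) ^ Module.finrank ℝ E * V := by
    rw [hT, Measure.real, Measure.addHaar_ball_of_pos _ _ (by positivity), ENNReal.toReal_mul,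
      ENNReal.toReal_ofReal (by positivity)]
    rfl
  have hbound : c * (κ * (s⁻¹) ^ m) * (volume : Measure E).real T ≤
      ∫ ξ in Ξ, Real.exp (F ξ - F x) * π ξ := by
    calc c * (κ * (s⁻¹) ^ m) * (volume : Measure E).real T
        = ∫ _ in T, c * (κ * (s⁻¹) ^ m) := by
          rw [setIntegral_const, smul_eq_mul, mul_comm]
      _ ≤ ∫ ξ in T, Real.exp (F ξ - F x) * π ξ := by
          refine setIntegral_mono_on (integrableOn_const measure_ball_lt_top.ne)
            (hint.mono_set hTΞ) measurableSet_ball fun ξ hξ => ?_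
          have h1 := hquad (ξ - x) (hTr ξ hξ)
          have h2 := hlow s⁻¹ (by positivity) hsη _ (hTw ξ hξ)
          rw [inv_smul_smul₀ hs0.ne', add_sub_cancel] at h2
          rw [add_sub_cancel] at h1
          have h3 := (hTn ξ hξ).le
          have h4 : -(C * R + A * R ^ 2) ≤ F ξ - F x := by
            refine le_trans (neg_le_neg ?_) h1
            calc C * s * ‖ξ - x‖ + A * s ^ 2 * ‖ξ - x‖ ^ 2
                = C * (s * ‖ξ - x‖) + A * (s * ‖ξ - x‖) ^ 2 := by ring
              _ ≤ _ := by gcongr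
          exact mul_le_mul (Real.exp_le_exp.2 h4) h2 (by positivity) (Real.exp_pos _).le
      _ ≤ _ := by
          refine setIntegral_mono_set hint ?_ hTΞ.eventuallyLE
          exact (ae_restrict_iff' hΞ).2 (ae_of_all _ fun ξ hξ =>
            mul_nonneg (Real.exp_pos _).le (hπ ξ hξ))
  calc c * κ * (ρ ^ Module.finrank ℝ E * V)
      = s ^ (Module.finrank ℝ E + m) * (c * (κ * (s⁻¹) ^ m) * (volume : Measure E).real T) := by
        rw [hvol, pow_add, div_pow, inv_pow]; field_simp
    _ ≤ _ := by gcongr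

end Laplace

/-! ### Stochastic orders of magnitude -/

section BigOInProb

variable {Ω : Type*} [MeasurableSpace Ω] {P : Measure Ω} {R R' : ℕ → Ω → ℝ} {r r' : ℕ → ℝ}

/-- It is enough to bound `R` on events of probability close to one. -/
theorem IsBigOInProb.of_forall_mem
    (h : ∀ ε : ℝ, 0 < ε → ∃ G : ℕ → Set Ω, (∀ᶠ n in atTop, P (G n)ᶜ ≤ ENNReal.ofReal ε) ∧
      ∃ C : ℝ, 0 < C ∧ ∀ᶠ n in atTop, ∀ ω ∈ G n, |R n ω| ≤ C * r n) : IsBigOInProb P R r := by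
  intro ε hε
  obtain ⟨G, hG, C, hC, h⟩ := h ε hε
  refine ⟨C, hC, ?_⟩
  filter_upwards [hG, h] with n h1 h2
  refine (measure_mono fun ω (hω : C * r n < |R n ω|) => ?_).trans h1
  exact Set.mem_compl fun hωG => absurd (h2 ω hωG) (not_le.2 hω)

theorem IsBigOInProb.add (h : IsBigOInProb P R r) (h' : IsBigOInProb P R' r) :
    IsBigOInProb P (fun n ω => R n ω + R' n ω) r := by
  intro ε hε
  obtain ⟨C, hC, h⟩ := h (ε / 2) (half_pos hε)
  obtain ⟨C', hC', h'⟩ := h' (ε / 2) (half_pos hε)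
  refine ⟨C + C', add_pos hC hC', ?_⟩
  filter_upwards [h, h'] with n h1 h2
  calc P {ω | (C + C') * r n < |R n ω + R' n ω|}
      ≤ P ({ω | C * r n < |R n ω|} ∪ {ω | C' * r n < |R' n ω|}) := by
        refine measure_mono fun ω hω => ?_
        simp only [Set.mem_ofPred_eq, Set.mem_union] at hω ⊢
        by_contra! hcon
        have := abs_add_le (R n ω) (R' n ω)
        linarith [hcon.1, hcon.2]
    _ ≤ _ := measure_union_le _ _
    _ ≤ ENNReal.ofReal (ε / 2) + ENNReal.ofReal (ε / 2) := add_le_add h1 h2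
    _ = ENNReal.ofReal ε := by
        rw [← ENNReal.ofReal_add (half_pos hε).le (half_pos hε).le, add_halves]

theorem IsBigOInProb.neg (h : IsBigOInProb P R r) : IsBigOInProb P (fun n ω => -R n ω) r := by
  simpa only [IsBigOInProb, abs_neg] using h

theorem IsBigOInProb.sub (h : IsBigOInProb P R r) (h' : IsBigOInProb P R' r) :
    IsBigOInProb P (fun n ω => R n ω - R' n ω) r := by
  simpa only [sub_eq_add_neg] using h.add h'.neg

theorem IsBigOInProb.mono (h : IsBigOInProb P R r) {c : ℝ} (hc : 0 < c)
    (hr : ∀ᶠ n in atTop, r n ≤ c * r' n) : IsBigOInProb P R r' := by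
  intro ε hε
  obtain ⟨C, hC, h⟩ := h ε hε
  refine ⟨C * c, mul_pos hC hc, ?_⟩
  filter_upwards [h, hr] with n h1 h2
  refine (measure_mono fun ω (hω : C * c * r' n < _) => ?_).trans h1
  have : C * r n ≤ C * (c * r' n) := by gcongr
  show C * r n < _
  linarith

theorem isBigOInProb_of_abs_le {a : ℕ → ℝ} {c : ℝ} (hc : 0 < c)
    (ha : ∀ᶠ n in atTop, |a n| ≤ c * r n) : IsBigOInProb P (fun n _ => a n) r :=
  .of_forall_mem fun _ _ => ⟨fun _ => Set.univ, by simp, c, hc,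
    ha.mono fun _ h _ _ => h⟩

end BigOInProb

/-! ### Sums of functions of i.i.d. observations -/

section Iid

variable {Y : Type*} [MeasurableSpace Y] [DiscreteMeasurableSpace Y]
  {Ω : Type*} [MeasurableSpace Ω] {P : Measure Ω} [IsProbabilityMeasure P]
  {y : ℕ → Ω → Y} {q : PMF Y}

/-- Sums of independent copies of a square integrable variable deviate from their mean by
`O_p(√n)`. -/
theorem isBigOInProb_sum_sub_mean (hmeas : ∀ i, Measurable (y i)) (hindep : iIndepFun y P)
    (hlaw : ∀ i, P.map (y i) = q.toMeasure) {a : Y → ℝ} (ha : MemLp a 2 q.toMeasure) :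
    IsBigOInProb P (fun n ω => ∑ i : Fin n, a (y i ω) - n * ∫ z, a z ∂q.toMeasure)
      (fun n => Real.sqrt n) := by
  have ham : Measurable a := Measurable.of_discrete
  have hX : ∀ i, MemLp (fun ω => a (y i ω)) 2 P := fun i => by
    have := ha
    rw [← hlaw i, memLp_map_measure_iff ham.aestronglyMeasurable (hmeas i).aemeasurable] at this
    exact this
  have hmean : ∀ i, ∫ ω, a (y i ω) ∂P = ∫ z, a z ∂q.toMeasure := fun i => by
    rw [← hlaw i, integral_map (hmeas i).aemeasurable ham.aestronglyMeasurable]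
  set V := variance a q.toMeasure with hV
  have hvar : ∀ i, variance (fun ω => a (y i ω)) P = V := fun i => by
    rw [hV, ← hlaw i, variance_map ham.aemeasurable (hmeas i).aemeasurable]
    rfl
  have hV0 : 0 ≤ V := variance_nonneg _ _
  intro ε hε
  -- Chebyshev gives the probability `V / C ^ 2`; the summand `1` keeps `C` positive when `V = 0`
  set C := Real.sqrt ((V + 1) / ε) with hC
  have hCpos : 0 < C := Real.sqrt_pos.2 (by positivity)
  refine ⟨C, hCpos, ?_⟩
  filter_upwards [eventually_gt_atTop 0] with n hn
  have hn' : (0 : ℝ) < n := by exact_mod_cast hn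
  set Z : Ω → ℝ := ∑ i : Fin n, fun ω => a (y i ω) with hZ
  have hZmem : MemLp Z 2 P := memLp_finsetSum' _ fun i _ => hX i
  have hZmean : ∫ ω, Z ω ∂P = n * ∫ z, a z ∂q.toMeasure := by
    simp only [hZ, Finset.sum_apply]
    rw [integral_finsetSum _ fun (i : Fin n) _ => (hX i).integrable (by norm_num)]
    simp [hmean]
  have hZvar : variance Z P = n * V := by
    rw [hZ, IndepFun.variance_sum (fun (i : Fin n) _ => hX i)]
    · simp [hvar]
    · intro i _ j _ hij
      exact (hindep.indepFun (i := (i : ℕ)) (j := (j : ℕ)) (by simpa [Fin.ext_iff] using hij)).comp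
        ham ham
  have hcheb := meas_ge_le_variance_div_sq hZmem (c := C * Real.sqrt n) (by positivity)
  calc _ ≤ P {ω | C * Real.sqrt n ≤ |Z ω - ∫ ω, Z ω ∂P|} := by
        refine measure_mono fun ω hω => ?_
        rw [Set.mem_ofPred_eq, hZmean, hZ, Finset.sum_apply]
        exact le_of_lt hω
    _ ≤ _ := hcheb
    _ ≤ ENNReal.ofReal ε := by
        refine ENNReal.ofReal_le_ofReal ?_
        rw [hZvar, mul_pow, Real.sq_sqrt hn'.le, hC, Real.sq_sqrt (by positivity),
          div_le_iff₀ (by positivity)]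
        have : ε * ((V + 1) / ε * n) = (V + 1) * n := by field_simp
        rw [this]
        nlinarith

/-- Vector-valued version for centred sums. -/
theorem isBigOInProb_norm_sum {d : ℕ} (hmeas : ∀ i, Measurable (y i)) (hindep : iIndepFun y P)
    (hlaw : ∀ i, P.map (y i) = q.toMeasure) {a : Y → EuclideanSpace ℝ (Fin d)}
    (ha : MemLp a 2 q.toMeasure) (hmean : ∫ z, a z ∂q.toMeasure = 0) :
    IsBigOInProb P (fun n ω => ‖∑ i : Fin n, a (y i ω)‖) (fun n => Real.sqrt n) := by
  have hcoord : ∀ j, IsBigOInProb P (fun n ω => ∑ i : Fin n, a (y i ω) j)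
      (fun n => Real.sqrt n) := by
    intro j
    have hj : MemLp (fun z => a z j) 2 q.toMeasure :=
      ha.continuousLinearMap_comp (EuclideanSpace.proj (𝕜 := ℝ) j)
    have h0 : ∫ z, a z j ∂q.toMeasure = 0 := by
      have := (EuclideanSpace.proj (𝕜 := ℝ) j).integral_comp_comm (ha.integrable (by norm_num))
      rw [hmean] at this
      simpa using this
    simpa [h0] using isBigOInProb_sum_sub_mean hmeas hindep hlaw hj
  -- the Euclidean norm is at most the sum of the absolute values of the coordinates
  have hsum : ∀ t : Finset (Fin d), IsBigOInProb P
      (fun n ω => ∑ j ∈ t, |∑ i : Fin n, a (y i ω) j|) (fun n => Real.sqrt n) := by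
    intro t
    induction t using Finset.induction_on with
    | empty =>
      simp only [Finset.sum_empty]
      exact isBigOInProb_of_abs_le (a := fun _ => 0) one_pos (.of_forall fun n => by simp)
    | insert j t hj ih =>
      simp only [Finset.sum_insert hj]
      refine IsBigOInProb.add ?_ ih
      simpa only [IsBigOInProb, abs_abs] using hcoord j
  intro ε hε
  obtain ⟨C, hC, h⟩ := hsum Finset.univ ε hε
  refine ⟨C, hC, h.mono fun n hn => (measure_mono fun ω hω => ?_).trans hn⟩
  refine lt_of_lt_of_le (b := ‖∑ i : Fin n, a (y i ω)‖) (by simpa using hω) ?_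
  rw [abs_of_nonneg (Finset.sum_nonneg fun _ _ => abs_nonneg _)]
  have h1 : ∀ v : EuclideanSpace ℝ (Fin d), ‖v‖ ≤ ∑ j, |v j| := by
    intro v
    rw [EuclideanSpace.norm_eq]
    refine Real.sqrt_le_iff.2 ⟨Finset.sum_nonneg fun _ _ => abs_nonneg _, ?_⟩
    exact Finset.sum_sq_le_sq_sum_of_nonneg fun _ _ => abs_nonneg _
  refine (h1 _).trans (le_of_eq ?_)
  refine Finset.sum_congr rfl fun j _ => ?_
  simp

/-- Weak law of large numbers. -/
theorem eventually_measure_norm_avg_sub_mean_le {B : Type*} [NormedAddCommGroup B] [NormedSpace ℝ B]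
    [CompleteSpace B] [SecondCountableTopology B] [MeasurableSpace B] [BorelSpace B]
    (hmeas : ∀ i, Measurable (y i))
    (hindep : iIndepFun y P) (hlaw : ∀ i, P.map (y i) = q.toMeasure) {a : Y → B}
    (ha : Integrable a q.toMeasure) {δ ε : ℝ} (hδ : 0 < δ) (hε : 0 < ε) :
    ∀ᶠ n : ℕ in atTop, P {ω | δ ≤ ‖(n : ℝ)⁻¹ • ∑ i : Fin n, a (y i ω) - ∫ z, a z ∂q.toMeasure‖} ≤
      ENNReal.ofReal ε := by
  have ham : Measurable a := Measurable.of_discrete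
  have hmean : ∫ ω, a (y 0 ω) ∂P = ∫ z, a z ∂q.toMeasure := by
    rw [← hlaw 0, integral_map (hmeas 0).aemeasurable ham.aestronglyMeasurable]
  have hint : Integrable (fun ω => a (y 0 ω)) P := by
    have := ha
    rw [← hlaw 0, integrable_map_measure ham.aestronglyMeasurable (hmeas 0).aemeasurable] at this
    exact this
  have hlln := strong_law_ae (μ := P) (fun i ω => a (y i ω)) hint
    (fun i j hij => (hindep.indepFun hij).comp ham ham)
    (fun i => (IdentDistrib.mk (hmeas i).aemeasurable (hmeas 0).aemeasurable
      (by rw [hlaw, hlaw])).comp ham)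
  have hm := tendstoInMeasure_of_tendsto_ae (μ := P)
    (f := fun (n : ℕ) ω => (n : ℝ)⁻¹ • ∑ i ∈ Finset.range n, a (y i ω))
    (fun n => ((Finset.measurable_sum _ fun i _ =>
      ham.comp (hmeas i)).const_smul _).aestronglyMeasurable) hlln
  rw [tendstoInMeasure_iff_norm] at hm
  have h0 : (0 : ℝ≥0∞) < ENNReal.ofReal ε := ENNReal.ofReal_pos.2 hε
  filter_upwards [(hm δ hδ).eventually (ge_mem_nhds h0)] with n hn
  rw [hmean] at hn
  simpa only [Finset.sum_range] using hn

end Iid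

namespace StatModel

variable {Y : Type*} {d : ℕ}

/-! ### Kullback-Leibler divergence between positive probability mass functions -/

section KL

variable [Countable Y] [MeasurableSpace Y] [DiscreteMeasurableSpace Y]

/-- Since `f` is positive, `q / f` is an honest density of `q` with respect to `f`. -/
theorem toMeasure_eq_withDensity {q f : PMF Y} (hf : ∀ z, 0 < f z) :
    q.toMeasure = f.toMeasure.withDensity (fun z => q z / f z) := by
  refine Measure.ext_of_singleton fun z => ?_
  rw [withDensity_apply _ (measurableSet_singleton z), lintegral_singleton,
    PMF.toMeasure_apply_singleton _ _ (measurableSet_singleton z),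
    PMF.toMeasure_apply_singleton _ _ (measurableSet_singleton z),
    ENNReal.div_mul_cancel (hf z).ne' (f.apply_ne_top z)]

theorem toMeasure_absolutelyContinuous {q f : PMF Y} (hf : ∀ z, 0 < f z) :
    q.toMeasure ≪ f.toMeasure := by
  rw [toMeasure_eq_withDensity (q := q) hf]
  exact withDensity_absolutelyContinuous _ _

theorem llr_toMeasure {q f : PMF Y} (hf : ∀ z, 0 < f z) :
    llr q.toMeasure f.toMeasure =ᵐ[q.toMeasure]
      fun z => Real.log ((q z).toReal / (f z).toReal) := by
  have h : q.toMeasure.rnDeriv f.toMeasure =ᵐ[f.toMeasure] fun z => q z / f z := by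
    conv_lhs => rw [toMeasure_eq_withDensity (q := q) hf]
    exact Measure.rnDeriv_withDensity _ Measurable.of_discrete
  filter_upwards [(toMeasure_absolutelyContinuous (q := q) hf).ae_le h] with z hz
  rw [llr, hz, ENNReal.toReal_div]

theorem kl_ne_top_iff (M : StatModel Y d) {q : PMF Y} {ξ : EuclideanSpace ℝ (Fin d)}
    (hf : ∀ z, 0 < M.f ξ z) : M.kl q ξ ≠ ∞ ↔
      Integrable (fun z => Real.log ((q z).toReal / (M.f ξ z).toReal)) q.toMeasure := by
  rw [kl, InformationTheory.klDiv_ne_top_iff, integrable_congr (llr_toMeasure hf)]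
  exact and_iff_right (toMeasure_absolutelyContinuous hf)

theorem toReal_kl (M : StatModel Y d) {q : PMF Y} {ξ : EuclideanSpace ℝ (Fin d)}
    (hf : ∀ z, 0 < M.f ξ z) : (M.kl q ξ).toReal =
      ∫ z, Real.log ((q z).toReal / (M.f ξ z).toReal) ∂q.toMeasure := by
  rw [kl, InformationTheory.toReal_klDiv_of_measure_eq (toMeasure_absolutelyContinuous hf)
    (by simp), integral_congr_ae (llr_toMeasure hf)]

theorem kl_eq_zero_iff (M : StatModel Y d) {q : PMF Y} {ξ : EuclideanSpace ℝ (Fin d)} :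
    M.kl q ξ = 0 ↔ M.f ξ = q := by
  rw [kl, InformationTheory.klDiv_eq_zero_iff, PMF.toMeasure_inj, eq_comm]

omit [DiscreteMeasurableSpace Y] [Countable Y] in
theorem klStar_le (M : StatModel Y d) {q : PMF Y} {ξ : EuclideanSpace ℝ (Fin d)} (hξ : ξ ∈ M.Ξ) :
    M.klStar q ≤ M.kl q ξ :=
  iInf₂_le ξ hξ

omit [MeasurableSpace Y] [DiscreteMeasurableSpace Y] [Countable Y] in
theorem log_div_eq (M : StatModel Y d) {q : PMF Y} {ξ : EuclideanSpace ℝ (Fin d)}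
    (hq : ∀ z, 0 < q z) (hf : ∀ z, 0 < M.f ξ z) (z : Y) :
    Real.log ((q z).toReal / (M.f ξ z).toReal) = Real.log (q z).toReal - M.logLik z ξ :=
  Real.log_div (ENNReal.toReal_pos (hq z).ne' (q.apply_ne_top z)).ne'
    (ENNReal.toReal_pos (hf z).ne' (PMF.apply_ne_top _ z)).ne'

end KL

end StatModel

/-! ### Quadratic bounds for a sample log-likelihood -/

section Expansion

variable {E : Type*} [NormedAddCommGroup E] [InnerProductSpace ℝ E] [FiniteDimensional ℝ E]
  {Ξ : Set E} {ξ : E}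

theorem exists_second_order_expansion {f : E → ℝ} (hopen : IsOpen Ξ) (hcd : ContDiffOn ℝ 2 f Ξ)
    {u : E} {r : ℝ} (hball : Metric.ball ξ r ⊆ Ξ) (hu : ‖u‖ < r) :
    ∃ ξ' ∈ Metric.ball ξ r, f (ξ + u) =
      f ξ + inner ℝ (gradient f ξ) u + fderiv ℝ (fderiv ℝ f) ξ' u u / 2 := by
  have hseg : ∀ θ ∈ Set.Icc (0 : ℝ) 1, ξ + θ • u ∈ Metric.ball ξ r := by
    intro θ hθ
    simp only [mem_ball_iff_norm, add_sub_cancel_left, norm_smul, Real.norm_eq_abs,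
      abs_of_nonneg hθ.1]
    nlinarith [hθ.2, norm_nonneg u]
  obtain ⟨θ, hθ, h⟩ := exists_taylor_lagrange_segment (f := f) (x := ξ) (u := u) 2
    (fun θ hθ => by exact_mod_cast hcd.contDiffAt (hopen.mem_nhds (hball (hseg θ hθ))))
  refine ⟨ξ + θ • u, hseg θ hθ, h.trans ?_⟩
  rw [iteratedFDeriv_two_apply]
  simp only [Finset.sum_range_succ, Finset.sum_range_zero, iteratedFDeriv_zero_apply,
    iteratedFDeriv_one_apply, gradient, InnerProductSpace.toDual_symm_apply]
  simp
  ring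

omit [FiniteDimensional ℝ E] in
theorem exists_norm_fderiv_fderiv_sub_lt {f : E → ℝ} (hopen : IsOpen Ξ) (hcd : ContDiffOn ℝ 2 f Ξ)
    (hξ : ξ ∈ Ξ) {ε : ℝ} (hε : 0 < ε) : ∃ δ > 0, ∀ ξ', dist ξ' ξ < δ →
      ‖fderiv ℝ (fderiv ℝ f) ξ' - fderiv ℝ (fderiv ℝ f) ξ‖ < ε := by
  have h : ContDiffAt ℝ 2 f ξ := hcd.contDiffAt (hopen.mem_nhds hξ)
  have h1 : ContDiffAt ℝ 1 (fderiv ℝ f) ξ := h.fderiv_right (by norm_num)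
  have h2 : ContDiffAt ℝ 0 (fderiv ℝ (fderiv ℝ f)) ξ := h1.fderiv_right (by norm_num)
  obtain ⟨δ, hδ, hb⟩ := Metric.continuousAt_iff.1 h2.continuousAt ε hε
  exact ⟨δ, hδ, fun ξ' hξ' => (dist_eq_norm _ _).symm.trans_lt (hb hξ')⟩

/-- A negative definite form is bounded above by a negative multiple of the squared norm, by
compactness of the unit sphere. -/
theorem exists_forall_le_neg_mul_sq_norm {Q : E → ℝ} (hcont : Continuous Q)
    (hhom : ∀ (t : ℝ) v, Q (t • v) = t ^ 2 * Q v) (hneg : ∀ v, v ≠ 0 → Q v < 0) :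
    ∃ b : ℝ, 0 < b ∧ ∀ v, Q v ≤ -b * ‖v‖ ^ 2 := by
  have hzero : Q 0 = 0 := by simpa using hhom 0 0
  rcases (Metric.sphere (0 : E) 1).eq_empty_or_nonempty with hemp | hne
  · refine ⟨1, one_pos, fun v => ?_⟩
    have hv : v = 0 := by
      by_contra hv
      have : ‖v‖⁻¹ • v ∈ Metric.sphere (0 : E) 1 := by
        simp [norm_smul, hv]
      rw [hemp] at this
      exact this
    simp [hv, hzero]
  · obtain ⟨w, hw, hmax⟩ := (isCompact_sphere _ _).exists_isMaxOn hne hcont.continuousOn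
    have hw0 : w ≠ 0 := by
      rintro rfl
      simp at hw
    refine ⟨-(Q w), by linarith [hneg w hw0], fun v => ?_⟩
    rcases eq_or_ne v 0 with rfl | hv
    · simp [hzero]
    have hvn : 0 < ‖v‖ := norm_pos_iff.2 hv
    have h1 : Q (‖v‖⁻¹ • v) ≤ Q w := hmax (by simp [norm_smul, hv])
    rw [hhom] at h1
    have h2 : Q v = (‖v‖⁻¹ ^ 2 * Q v) * ‖v‖ ^ 2 := by field_simp
    rw [h2, neg_neg]
    gcongr

/-- The quadratic form with coefficients `m` in an orthonormal basis. -/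
noncomputable def coordQuadForm {ι : Type*} [Fintype ι] (e : OrthonormalBasis ι ℝ E) (m : ι × ι → ℝ)
    (u : E) : ℝ :=
  ∑ ij : ι × ι, inner ℝ (e ij.1) u * inner ℝ (e ij.2) u * m ij

omit [FiniteDimensional ℝ E] in
theorem coordQuadForm_apply_bilin {ι : Type*} [Fintype ι] (e : OrthonormalBasis ι ℝ E)
    (A : E →L[ℝ] E →L[ℝ] ℝ) (u : E) :
    coordQuadForm e (fun ij => A (e ij.1) (e ij.2)) u = A u u := by
  conv_rhs => rw [← e.sum_repr' u]
  simp only [coordQuadForm, map_sum, map_smul, sum_apply, smul_apply, smul_eq_mul,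
    Finset.mul_sum, Fintype.sum_prod_type, mul_assoc]
  rw [Finset.sum_comm]
  refine Finset.sum_congr rfl fun i _ => Finset.sum_congr rfl fun j _ => ?_
  ring

omit [FiniteDimensional ℝ E] in
theorem abs_coordQuadForm_le {ι : Type*} [Fintype ι] (e : OrthonormalBasis ι ℝ E) (m : ι × ι → ℝ)
    (u : E) : |coordQuadForm e m u| ≤ Fintype.card (ι × ι) * ‖m‖ * ‖u‖ ^ 2 := by
  refine (Finset.abs_sum_le_sum_abs _ _).trans ?_
  calc _ ≤ ∑ _ij : ι × ι, ‖u‖ * ‖u‖ * ‖m‖ := by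
        refine Finset.sum_le_sum fun ij _ => ?_
        rw [abs_mul, abs_mul]
        have h : ∀ i, |inner ℝ (e i) u| ≤ ‖u‖ := fun i => by
          simpa using abs_real_inner_le_norm (e i) u
        gcongr
        · exact h _
        · exact h _
        · exact norm_le_pi_norm m ij
    _ = _ := by rw [Finset.sum_const, Finset.card_univ, nsmul_eq_mul]; ring

variable {Y : Type*} [Countable Y] [MeasurableSpace Y] [DiscreteMeasurableSpace Y]
  {μ : Measure Y} {ℓ : Y → E → ℝ} {r : ℝ} {c : Y → ℝ}

/-- The expected gradient vanishes at an interior maximum of the expectation of `ℓ`. The maximum is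
expressed through the increments of `ℓ`, as `ℓ` itself is not assumed to be integrable. -/
theorem integral_gradient_eq_zero (hopen : IsOpen Ξ) (hcd : ∀ z, ContDiffOn ℝ 2 (ℓ z) Ξ)
    (hr : 0 < r) (hball : Metric.ball ξ r ⊆ Ξ) (hc : Integrable c μ)
    (hcb : ∀ z, ∀ ξ' ∈ Metric.ball ξ r, ‖fderiv ℝ (fderiv ℝ (ℓ z)) ξ'‖ ≤ c z)
    (hs : Integrable (fun z => gradient (ℓ z) ξ) μ)
    (hmax : ∀ u, ‖u‖ < r → Integrable (fun z => ℓ z (ξ + u) - ℓ z ξ) μ →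
      ∫ z, (ℓ z (ξ + u) - ℓ z ξ) ∂μ ≤ 0) :
    ∫ z, gradient (ℓ z) ξ ∂μ = 0 := by
  set e := ∫ z, gradient (ℓ z) ξ ∂μ with he
  set B := ∫ z, c z ∂μ with hB
  have key : ∀ u, ‖u‖ < r → inner ℝ e u ≤ B / 2 * ‖u‖ ^ 2 := by
    intro u hu
    set D : Y → ℝ := fun z => ℓ z (ξ + u) - ℓ z ξ with hD
    have hlow : ∀ z, |D z - inner ℝ (gradient (ℓ z) ξ) u| ≤ c z / 2 * ‖u‖ ^ 2 := by
      intro z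
      obtain ⟨ξ', hξ', h⟩ := exists_second_order_expansion hopen (hcd z) hball hu
      have h1 := (fderiv ℝ (fderiv ℝ (ℓ z)) ξ').le_opNorm₂ u u
      have h2 := hcb z ξ' hξ'
      have h3 : D z - inner ℝ (gradient (ℓ z) ξ) u = fderiv ℝ (fderiv ℝ (ℓ z)) ξ' u u / 2 := by
        rw [hD]; simp only; rw [h]; ring
      rw [h3, abs_div, abs_two, ← Real.norm_eq_abs]
      have h4 : ‖fderiv ℝ (fderiv ℝ (ℓ z)) ξ'‖ * ‖u‖ * ‖u‖ ≤ c z * ‖u‖ * ‖u‖ := by gcongr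
      linarith
    have hsu : Integrable (fun z => (inner ℝ (gradient (ℓ z) ξ) u : ℝ)) μ := hs.inner_const u
    have hcu : Integrable (fun z => c z / 2 * ‖u‖ ^ 2) μ := (hc.div_const 2).mul_const _
    have hDs : Integrable (fun z => D z - inner ℝ (gradient (ℓ z) ξ) u) μ :=
      hcu.mono' .of_discrete (ae_of_all _ fun z => by rw [Real.norm_eq_abs]; exact hlow z)
    have hDi : Integrable D μ := by
      refine (hDs.add hsu).congr (ae_of_all _ fun z => ?_)
      simp
    have h5 : ∫ z, (inner ℝ (gradient (ℓ z) ξ) u - c z / 2 * ‖u‖ ^ 2) ∂μ ≤ ∫ z, D z ∂μ :=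
      integral_mono (hsu.sub hcu) hDi fun z => by
        have := abs_le.1 (hlow z)
        simp only
        linarith [this.1]
    rw [integral_sub hsu hcu, integral_mul_const, integral_div] at h5
    have h6 : ∫ z, (inner ℝ (gradient (ℓ z) ξ) u : ℝ) ∂μ = inner ℝ e u := by
      rw [real_inner_comm, he, ← integral_inner (𝕜 := ℝ) hs u]
      exact integral_congr_ae (ae_of_all _ fun z => real_inner_comm _ _)
    rw [h6] at h5
    linarith [hmax u hu hDi]
  -- apply the inequality to small multiples of the expected gradient itself
  by_contra hne
  have hepos : 0 < ‖e‖ := norm_pos_iff.2 hne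
  have hB0 : 0 ≤ B := integral_nonneg fun z =>
    le_trans (ContinuousLinearMap.opNorm_nonneg _) (hcb z ξ (Metric.mem_ball_self hr))
  set t := min (r / (2 * ‖e‖)) (1 / (B + 1)) with ht
  have ht0 : 0 < t := by positivity
  have ht1 : t * (2 * ‖e‖) ≤ r := by
    rw [← le_div_iff₀ (by positivity)]; exact min_le_left _ _
  have ht2 : t * (B + 1) ≤ 1 := by
    rw [← le_div_iff₀ (by positivity)]; exact min_le_right _ _
  have hn : ‖t • e‖ = t * ‖e‖ := by rw [norm_smul, Real.norm_eq_abs, abs_of_pos ht0]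
  have h := key (t • e) (by rw [hn]; nlinarith)
  rw [inner_smul_right, real_inner_self_eq_norm_sq, hn] at h
  have h7 : B / 2 * (t * ‖e‖) ^ 2 = (t * B) * (t * ‖e‖ ^ 2) / 2 := by ring
  have h8 : 0 < t * ‖e‖ ^ 2 := by positivity
  rw [h7] at h
  nlinarith

omit [FiniteDimensional ℝ E] in
/-- The Hessian of `ℓ` has a modulus of continuity at `ξ` whose expectation is arbitrarily small on
small balls, by dominated convergence. -/
theorem exists_hessian_modulus (hopen : IsOpen Ξ) (hcd : ∀ z, ContDiffOn ℝ 2 (ℓ z) Ξ)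
    (hr : 0 < r) (hball : Metric.ball ξ r ⊆ Ξ) (hc : Integrable c μ)
    (hcb : ∀ z, ∀ ξ' ∈ Metric.ball ξ r, ‖fderiv ℝ (fderiv ℝ (ℓ z)) ξ'‖ ≤ c z)
    {η : ℝ} (hη : 0 < η) :
    ∃ r' : ℝ, 0 < r' ∧ Metric.ball ξ r' ⊆ Ξ ∧ ∃ W : Y → ℝ, Integrable W μ ∧ ∫ z, W z ∂μ < η ∧
      ∀ z, ∀ ξ' ∈ Metric.ball ξ r',
        ‖fderiv ℝ (fderiv ℝ (ℓ z)) ξ' - fderiv ℝ (fderiv ℝ (ℓ z)) ξ‖ ≤ W z := by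
  set H : Y → E → E →L[ℝ] E →L[ℝ] ℝ := fun z => fderiv ℝ (fderiv ℝ (ℓ z)) with hH
  set ρ : ℕ → ℝ := fun k => r / (k + 1) with hρ
  have hρ0 : ∀ k, 0 < ρ k := fun k => by positivity
  have hρr : ∀ k, ρ k ≤ r := fun k => by
    rw [hρ]; exact div_le_self hr.le (by linarith [(Nat.cast_nonneg k : (0 : ℝ) ≤ k)])
  have hρt : Tendsto ρ atTop (nhds 0) := tendsto_const_div_atTop_nhds_zero_nat r |>.comp
    (tendsto_add_atTop_nat 1) |>.congr fun k => by simp [hρ]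
  set W : ℕ → Y → ℝ := fun k z => ⨆ ξ' : Metric.ball ξ (ρ k), ‖H z ξ' - H z ξ‖ with hW
  have hb : ∀ k z (ξ' : Metric.ball ξ (ρ k)), ‖H z ξ' - H z ξ‖ ≤ 2 * c z := by
    intro k z ξ'
    have h1 := hcb z ξ' (Metric.ball_subset_ball (hρr k) ξ'.2)
    have h2 := hcb z ξ (Metric.mem_ball_self hr)
    have h3 := norm_sub_le (H z ξ') (H z ξ)
    linarith
  have hne : ∀ k, Nonempty (Metric.ball ξ (ρ k)) := fun k =>
    ⟨⟨ξ, Metric.mem_ball_self (hρ0 k)⟩⟩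
  have hW0 : ∀ k z, 0 ≤ W k z := fun k z =>
    Real.iSup_nonneg fun _ => ContinuousLinearMap.opNorm_nonneg _
  have hWc : ∀ k z, W k z ≤ 2 * c z := fun k z => ciSup_le (hb k z)
  have hlim : Tendsto (fun k => ∫ z, W k z ∂μ) atTop (nhds (∫ _, (0 : ℝ) ∂μ)) := by
    refine tendsto_integral_of_dominated_convergence (fun z => 2 * c z)
      (fun k => .of_discrete) (hc.const_mul 2) (fun k => ae_of_all _ fun z => ?_)
      (ae_of_all _ fun z => ?_)
    · rw [Real.norm_eq_abs, abs_of_nonneg (hW0 k z)]; exact hWc k z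
    · refine Metric.tendsto_atTop.2 fun ε hε => ?_
      obtain ⟨δ, hδ, hδb⟩ := exists_norm_fderiv_fderiv_sub_lt hopen (hcd z)
        (hball (Metric.mem_ball_self hr)) (half_pos hε)
      obtain ⟨N, hN⟩ := eventually_atTop.1 (hρt.eventually (gt_mem_nhds hδ))
      refine ⟨N, fun k hk => ?_⟩
      rw [Real.dist_eq, sub_zero, abs_of_nonneg (hW0 k z)]
      refine lt_of_le_of_lt (ciSup_le fun ξ' => ?_) (half_lt_self hε)
      exact (hδb _ (lt_trans (Metric.mem_ball.1 ξ'.2) (hN k hk))).le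
  rw [integral_zero] at hlim
  obtain ⟨k, hk⟩ := (hlim.eventually (gt_mem_nhds hη)).exists
  refine ⟨ρ k, hρ0 k, (Metric.ball_subset_ball (hρr k)).trans hball, W k,
    (hc.const_mul 2).mono' .of_discrete (ae_of_all _ fun z => ?_), hk, fun z ξ' hξ' => ?_⟩
  · rw [Real.norm_eq_abs, abs_of_nonneg (hW0 k z)]; exact hWc k z
  · exact le_ciSup (f := fun ξ' : Metric.ball ξ (ρ k) => ‖H z ξ' - H z ξ‖)
      ⟨2 * c z, by rintro _ ⟨a, rfl⟩; exact hb k z a⟩ ⟨ξ', hξ'⟩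

/-- With probability close to one, the increments of the sample log-likelihood at `ξ` lie, on a
fixed ball, between two quadratic functions with leading coefficients of order `n` and linear
coefficients of order `√n`. -/
theorem exists_quadratic_bounds (hopen : IsOpen Ξ) (hcd : ∀ z, ContDiffOn ℝ 2 (ℓ z) Ξ)
    {q : PMF Y} (hr : 0 < r) (hball : Metric.ball ξ r ⊆ Ξ) (hc : Integrable c q.toMeasure)
    (hcb : ∀ z, ∀ ξ' ∈ Metric.ball ξ r, ‖fderiv ℝ (fderiv ℝ (ℓ z)) ξ'‖ ≤ c z)
    (hneg : ∀ v, v ≠ 0 → ∫ z, fderiv ℝ (fderiv ℝ (ℓ z)) ξ v v ∂q.toMeasure < 0)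
    {Ω : Type*} [MeasurableSpace Ω] {P : Measure Ω} [IsProbabilityMeasure P]
    {y : ℕ → Ω → Y} (hmeas : ∀ i, Measurable (y i)) (hindep : iIndepFun y P)
    (hlaw : ∀ i, P.map (y i) = q.toMeasure)
    (hscore : IsBigOInProb P (fun n ω => ‖∑ i : Fin n, gradient (ℓ (y i ω)) ξ‖)
      (fun n => Real.sqrt n)) :
    ∃ a A r' : ℝ, 0 < a ∧ 0 < A ∧ 0 < r' ∧ Metric.ball ξ r' ⊆ Ξ ∧ ∀ ε : ℝ, 0 < ε →
      ∃ (C : ℝ) (G : ℕ → Set Ω), 0 < C ∧ (∀ᶠ n in atTop, P (G n)ᶜ ≤ ENNReal.ofReal ε) ∧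
        ∀ n, ∀ ω ∈ G n, ∀ u, ‖u‖ < r' →
          ∑ i : Fin n, ℓ (y i ω) (ξ + u) - ∑ i : Fin n, ℓ (y i ω) ξ ≤
              C * Real.sqrt n * ‖u‖ - a * Real.sqrt n ^ 2 * ‖u‖ ^ 2 ∧
            -(C * Real.sqrt n * ‖u‖ + A * Real.sqrt n ^ 2 * ‖u‖ ^ 2) ≤
              ∑ i : Fin n, ℓ (y i ω) (ξ + u) - ∑ i : Fin n, ℓ (y i ω) ξ := by
  set H : Y → E →L[ℝ] E →L[ℝ] ℝ := fun z => fderiv ℝ (fderiv ℝ (ℓ z)) ξ with hH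
  -- the law of large numbers is applied to the coefficients of the Hessian in a basis, as elements
  -- of a finite product of lines
  set e := stdOrthonormalBasis ℝ E with he
  set m : Y → Fin (Module.finrank ℝ E) × Fin (Module.finrank ℝ E) → ℝ :=
    fun z ij => H z (e ij.1) (e ij.2) with hm
  have hmH : ∀ z u, coordQuadForm e (m z) u = H z u u := fun z u =>
    coordQuadForm_apply_bilin e (H z) u
  have hmi : Integrable m q.toMeasure := by
    refine Integrable.of_eval fun ij => hc.mono' .of_discrete (ae_of_all _ fun z => ?_)
    have h1 := (H z).le_opNorm₂ (e ij.1) (e ij.2)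
    simp only [e.norm_eq_one, mul_one] at h1
    exact h1.trans (hcb z ξ (Metric.mem_ball_self hr))
  set J := ∫ z, m z ∂q.toMeasure with hJ
  set Q : E → ℝ := coordQuadForm e J with hQdef
  have hQ : ∀ v, Q v = ∫ z, H z v v ∂q.toMeasure := by
    intro v
    have hmi' : ∀ ij, Integrable (fun z => m z ij) q.toMeasure := fun ij => hmi.eval ij
    simp only [← hmH, hQdef, coordQuadForm]
    rw [integral_finsetSum _ fun ij _ => (hmi' ij).const_mul _]
    refine Finset.sum_congr rfl fun ij _ => ?_
    rw [integral_const_mul, hJ, eval_integral hmi']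
  obtain ⟨b, hb, hQb⟩ := exists_forall_le_neg_mul_sq_norm (Q := Q)
    (by rw [hQdef]; unfold coordQuadForm; fun_prop)
    (fun t v => by
      simp only [hQdef, coordQuadForm, inner_smul_right, Finset.mul_sum]
      exact Finset.sum_congr rfl fun _ _ => by ring)
    (fun v hv => by rw [hQ]; exact hneg v hv)
  set N : ℝ := ((Fintype.card (Fin (Module.finrank ℝ E) × Fin (Module.finrank ℝ E)) : ℕ) : ℝ)
    with hN
  have hN0 : 0 ≤ N := Nat.cast_nonneg _
  obtain ⟨r', hr', hball', W, hWi, hWb, hWmod⟩ :=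
    exists_hessian_modulus hopen hcd hr hball hc hcb (η := b / 8) (by positivity)
  refine ⟨b / 4, N * ‖J‖ + b, r', by positivity, by positivity, hr', hball', fun ε hε => ?_⟩
  obtain ⟨C, hC, hS⟩ := hscore (ε / 3) (by positivity)
  have hLH := eventually_measure_norm_avg_sub_mean_le hmeas hindep hlaw hmi
    (δ := b / 8 / (N + 1)) (ε := ε / 3) (by positivity) (by positivity)
  have hLW := eventually_measure_norm_avg_sub_mean_le hmeas hindep hlaw hWi
    (δ := b / 8) (ε := ε / 3) (by positivity) (by positivity)
  set S₁ : ℕ → Set Ω := fun n =>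
    {ω | C * Real.sqrt n < |‖∑ i : Fin n, gradient (ℓ (y i ω)) ξ‖|} with hS₁
  set S₂ : ℕ → Set Ω := fun n => 
    {ω | b / 8 / (N + 1) ≤ ‖(n : ℝ)⁻¹ • ∑ i : Fin n, m (y i ω) - J‖} with hS₂
  set S₃ : ℕ → Set Ω := fun n =>
    {ω | b / 8 ≤ ‖(n : ℝ)⁻¹ • ∑ i : Fin n, W (y i ω) - ∫ z, W z ∂q.toMeasure‖} with hS₃
  refine ⟨C, fun n => (S₁ n ∪ S₂ n ∪ S₃ n)ᶜ, hC, ?_, ?_⟩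
  · filter_upwards [hS, hLH, hLW] with n h1 h2 h3
    rw [compl_compl]
    calc P (S₁ n ∪ S₂ n ∪ S₃ n) ≤ P (S₁ n) + P (S₂ n) + P (S₃ n) :=
          (measure_union_le _ _).trans (add_le_add (measure_union_le _ _) le_rfl)
      _ ≤ ENNReal.ofReal (ε / 3) + ENNReal.ofReal (ε / 3) + ENNReal.ofReal (ε / 3) := by
          gcongr
      _ = ENNReal.ofReal ε := by
          rw [← ENNReal.ofReal_add (by positivity) (by positivity),
            ← ENNReal.ofReal_add (by positivity) (by positivity)]
          congr 1; ring
  · intro n ω hω u hu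
    simp only [Set.mem_compl_iff, Set.mem_union, not_or] at hω
    obtain ⟨⟨h1, h2⟩, h3⟩ := hω
    rcases Nat.eq_zero_or_pos n with rfl | hn
    · simp
    have hn' : (0 : ℝ) < n := by exact_mod_cast hn
    have h1' : ‖∑ i : Fin n, gradient (ℓ (y i ω)) ξ‖ ≤ C * Real.sqrt n := by
      have := not_lt.1 (show ¬ (C * Real.sqrt n < |‖∑ i : Fin n, gradient (ℓ (y i ω)) ξ‖|) from h1)
      rwa [abs_of_nonneg (norm_nonneg _)] at this
    have h2' : ‖(n : ℝ)⁻¹ • ∑ i : Fin n, m (y i ω) - J‖ < b / 8 / (N + 1) := not_le.1 h2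
    have h3' : ‖(n : ℝ)⁻¹ • ∑ i : Fin n, W (y i ω) - ∫ z, W z ∂q.toMeasure‖ < b / 8 := not_le.1 h3
    set S := ∑ i : Fin n, gradient (ℓ (y i ω)) ξ with hSdef
    have hsumW : ∑ i : Fin n, W (y i ω) ≤ n * (b / 4) := by
      have h4 := (abs_lt.1 h3').2
      rw [smul_eq_mul] at h4
      have h5 : (n : ℝ)⁻¹ * ∑ i : Fin n, W (y i ω) ≤ b / 4 := by linarith
      rwa [inv_mul_le_iff₀ hn'] at h5
    have hsumH : |(∑ i : Fin n, H (y i ω) u u) - n * Q u| ≤ n * (b / 8) * ‖u‖ ^ 2 := by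
      have h4 := abs_coordQuadForm_le e ((n : ℝ)⁻¹ • ∑ i : Fin n, m (y i ω) - J) u
      have h5 : coordQuadForm e ((n : ℝ)⁻¹ • ∑ i : Fin n, m (y i ω) - J) u =
          (n : ℝ)⁻¹ * ((∑ i : Fin n, H (y i ω) u u) - n * Q u) := by
        simp only [← hmH, hQdef, coordQuadForm]
        rw [Finset.sum_comm, mul_sub, inv_mul_cancel_left₀ hn'.ne', Finset.mul_sum,
          ← Finset.sum_sub_distrib]
        refine Finset.sum_congr rfl fun ij _ => ?_
        simp only [Pi.sub_apply, Pi.smul_apply, Finset.sum_apply, smul_eq_mul, ← Finset.mul_sum]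
        ring
      rw [h5, abs_mul, abs_of_pos (inv_pos.2 hn'), inv_mul_le_iff₀ hn'] at h4
      refine h4.trans ?_
      have h6 : N * ‖(n : ℝ)⁻¹ • ∑ i : Fin n, m (y i ω) - J‖ ≤ b / 8 := by
        calc _ ≤ (N + 1) * (b / 8 / (N + 1)) := by gcongr; linarith
          _ = _ := by field_simp
      calc _ ≤ (n : ℝ) * (b / 8 * ‖u‖ ^ 2) := by gcongr
        _ = _ := by ring
    -- the increment is the linear term plus half of the Hessian term, up to the modulus
    have hinc : |(∑ i : Fin n, ℓ (y i ω) (ξ + u) - ∑ i : Fin n, ℓ (y i ω) ξ) - inner ℝ S u -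
        (∑ i : Fin n, H (y i ω) u u) / 2| ≤ n * (b / 4) * ‖u‖ ^ 2 / 2 := by
      have h4 : (∑ i : Fin n, ℓ (y i ω) (ξ + u) - ∑ i : Fin n, ℓ (y i ω) ξ) - inner ℝ S u -
          (∑ i : Fin n, H (y i ω) u u) / 2 = ∑ i : Fin n, (ℓ (y i ω) (ξ + u) - ℓ (y i ω) ξ -
            inner ℝ (gradient (ℓ (y i ω)) ξ) u - H (y i ω) u u / 2) := by
        rw [hSdef, sum_inner, Finset.sum_div]
        simp only [Finset.sum_sub_distrib]
      rw [h4]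
      refine (Finset.abs_sum_le_sum_abs _ _).trans ?_
      calc _ ≤ ∑ i : Fin n, W (y i ω) * (‖u‖ ^ 2 / 2) := by
            refine Finset.sum_le_sum fun i _ => ?_
            obtain ⟨ξ', hξ', h⟩ := exists_second_order_expansion hopen (hcd (y i ω)) hball' hu
            have h5 := (fderiv ℝ (fderiv ℝ (ℓ (y i ω))) ξ' - H (y i ω)).le_opNorm₂ u u
            have h6 := hWmod (y i ω) ξ' hξ'
            have h7 : ℓ (y i ω) (ξ + u) - ℓ (y i ω) ξ - inner ℝ (gradient (ℓ (y i ω)) ξ) u -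
                H (y i ω) u u / 2 = (fderiv ℝ (fderiv ℝ (ℓ (y i ω))) ξ' - H (y i ω)) u u / 2 := by
              rw [h]; simp only [sub_apply]; ring
            rw [h7, abs_div, abs_two, ← Real.norm_eq_abs]
            have h8 : ‖fderiv ℝ (fderiv ℝ (ℓ (y i ω))) ξ' - H (y i ω)‖ * ‖u‖ * ‖u‖ ≤
                W (y i ω) * ‖u‖ * ‖u‖ := by gcongr
            linarith
        _ = (∑ i : Fin n, W (y i ω)) * (‖u‖ ^ 2 / 2) := by rw [Finset.sum_mul]
        _ ≤ (n * (b / 4)) * (‖u‖ ^ 2 / 2) := by gcongr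
        _ = _ := by ring
    have hin : |(inner ℝ S u : ℝ)| ≤ C * Real.sqrt n * ‖u‖ :=
      (abs_real_inner_le_norm _ _).trans (by gcongr)
    have hJ1 : n * Q u ≤ n * (-b * ‖u‖ ^ 2) := by gcongr; exact hQb u
    have hJ2 : n * -(N * ‖J‖ * ‖u‖ ^ 2) ≤ n * Q u := by
      have h5 := (abs_le.1 (abs_coordQuadForm_le e J u)).1
      gcongr
    have hnu : 0 ≤ (n : ℝ) * b * ‖u‖ ^ 2 := by positivity
    have hnJ : 0 ≤ (n : ℝ) * (N * ‖J‖) * ‖u‖ ^ 2 := by positivity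
    rw [Real.sq_sqrt hn'.le]
    have e1 := abs_le.1 hinc
    have e2 := abs_le.1 hsumH
    have e3 := abs_le.1 hin
    constructor
    · nlinarith [e1.2, e2.2, e3.2]
    · nlinarith [e1.1, e2.1, e3.1]

end Expansion

namespace StatModel

/-! ### Marginal likelihoods -/

section Marginal

variable {Y : Type*} {d : ℕ} {M : StatModel Y d} {π : EuclideanSpace ℝ (Fin d) → ℝ}

theorem likelihood_eq_exp (hpos : ∀ ξ ∈ M.Ξ, ∀ z, 0 < M.f ξ z) {ξ : EuclideanSpace ℝ (Fin d)}
    (hξ : ξ ∈ M.Ξ) {n : ℕ} (y : Fin n → Y) :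
    M.likelihood y ξ = Real.exp (∑ i, M.logLik (y i) ξ) := by
  rw [Real.exp_sum, likelihood]
  refine Finset.prod_congr rfl fun i _ => ?_
  rw [logLik, Real.exp_log (ENNReal.toReal_pos (hpos ξ hξ _).ne' (PMF.apply_ne_top _ _))]

theorem likelihood_nonneg {n : ℕ} (y : Fin n → Y) (ξ : EuclideanSpace ℝ (Fin d)) :
    0 ≤ M.likelihood y ξ :=
  Finset.prod_nonneg fun _ _ => ENNReal.toReal_nonneg

theorem likelihood_le_one {n : ℕ} (y : Fin n → Y) (ξ : EuclideanSpace ℝ (Fin d)) :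
    M.likelihood y ξ ≤ 1 :=
  Finset.prod_le_one (fun _ _ => ENNReal.toReal_nonneg) fun _ _ =>
    ENNReal.toReal_le_of_le_ofReal zero_le_one (by simpa using PMF.coe_le_one _ _)

theorem integrableOn_likelihood_mul (hΞ : MeasurableSet M.Ξ)
    (hpos : ∀ ξ ∈ M.Ξ, ∀ z, 0 < M.f ξ z) (hcont : ∀ z, ContinuousOn (M.logLik z) M.Ξ)
    (hπi : IntegrableOn π M.Ξ) {n : ℕ} (y : Fin n → Y) :
    IntegrableOn (fun ξ => M.likelihood y ξ * π ξ) M.Ξ := by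
  have hc : ContinuousOn (M.likelihood y) M.Ξ := by
    have h : ContinuousOn (fun ξ => Real.exp (∑ i, M.logLik (y i) ξ)) M.Ξ :=
      Real.continuous_exp.comp_continuousOn (continuousOn_finsetSum _ fun i _ => hcont (y i))
    exact h.congr fun ξ hξ => likelihood_eq_exp hpos hξ y
  refine Integrable.mono' hπi.norm ((hc.aestronglyMeasurable hΞ).mul hπi.1)
    (ae_of_all _ fun ξ => ?_)
  rw [norm_mul, Real.norm_eq_abs, abs_of_nonneg (likelihood_nonneg y ξ)]
  exact mul_le_of_le_one_left (norm_nonneg _) (likelihood_le_one y ξ)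

theorem marginal_pos (hΞ : MeasurableSet M.Ξ)
    (hpos : ∀ ξ ∈ M.Ξ, ∀ z, 0 < M.f ξ z) (hcont : ∀ z, ContinuousOn (M.logLik z) M.Ξ)
    (hπ : ∀ ξ ∈ M.Ξ, 0 ≤ π ξ) (hπi : IntegrableOn π M.Ξ) (hπpos : 0 < ∫ ξ in M.Ξ, π ξ)
    {n : ℕ} (y : Fin n → Y) : 0 < M.marginal π y := by
  have h0 : 0 ≤ᵐ[volume.restrict M.Ξ] π := (ae_restrict_iff' hΞ).2 (ae_of_all _ hπ)
  have h1 : 0 ≤ᵐ[volume.restrict M.Ξ] fun ξ => M.likelihood y ξ * π ξ :=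
    (ae_restrict_iff' hΞ).2 (ae_of_all _ fun ξ hξ =>
      mul_nonneg (likelihood_nonneg y ξ) (hπ ξ hξ))
  rw [setIntegral_pos_iff_support_of_nonneg_ae h0 hπi] at hπpos
  rw [marginal, setIntegral_pos_iff_support_of_nonneg_ae h1
    (integrableOn_likelihood_mul hΞ hpos hcont hπi y)]
  refine hπpos.trans_le (measure_mono fun ξ hξ => ⟨?_, hξ.2⟩)
  rw [Function.mem_support, likelihood_eq_exp hpos hξ.2]
  exact mul_ne_zero (Real.exp_ne_zero _) hξ.1

/-- In a singleton model the marginal likelihood is the likelihood. -/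
theorem marginal_eq_of_singleton {ξ : EuclideanSpace ℝ (Fin d)} (hΞ : M.Ξ = {ξ})
    (hpos : ∀ ξ ∈ M.Ξ, ∀ z, 0 < M.f ξ z) (hπ : ∫ ξ in M.Ξ, π ξ = 1) {n : ℕ} (y : Fin n → Y) :
    M.marginal π y = Real.exp (∑ i, M.logLik (y i) ξ) := by
  have hξ : ξ ∈ M.Ξ := by rw [hΞ]; exact Set.mem_singleton _
  have hmeas : MeasurableSet M.Ξ := by rw [hΞ]; exact measurableSet_singleton _
  rw [marginal, setIntegral_congr_fun (g := fun ξ' => M.likelihood y ξ * π ξ') hmeas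
    (fun ξ' hξ' => by
      rw [hΞ, Set.mem_singleton_iff] at hξ'
      rw [hξ']), integral_const_mul, hπ, mul_one, likelihood_eq_exp hpos hξ]

end Marginal

/-! ### Laplace approximation of marginal likelihoods -/

section LaplaceApproximation

variable {Y : Type*} [Countable Y] [MeasurableSpace Y] [DiscreteMeasurableSpace Y] {d : ℕ}
  {M : StatModel Y d} {q : PMF Y} {ξ : EuclideanSpace ℝ (Fin d)}

/-- The expected score vanishes at the projection, an interior minimum of the Kullback-Leibler
divergence. -/
theorem integral_score_eq_zero (hR : M.IsRegularNonsingleton q) (hξ : M.IsKLProj q ξ) :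
    ∫ z, M.score z ξ ∂q.toMeasure = 0 := by
  obtain ⟨r, hr, hball, c, hc, hcb⟩ := hR.hessian_dominated ξ hξ
  have hv : Integrable (fun z => Real.log ((q z).toReal / (M.f ξ z).toReal)) q.toMeasure :=
    (hR.variance_finite ξ hξ).integrable (by norm_num)
  refine integral_gradient_eq_zero (ℓ := M.logLik) hR.isOpen hR.contDiffOn hr hball hc
    (fun z ξ' hξ' => hcb z ξ' hξ') ((hR.memLp_score ξ hξ).integrable (by norm_num))
    fun u hu hDi => ?_
  have hmem : ξ + u ∈ M.Ξ := hball (by simpa using hu)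
  have hpos' := hR.pos _ hmem
  have hlogeq : ∀ z, Real.log ((q z).toReal / (M.f (ξ + u) z).toReal) =
      Real.log ((q z).toReal / (M.f ξ z).toReal) - (M.logLik z (ξ + u) - M.logLik z ξ) := by
    intro z
    rw [M.log_div_eq hR.sampling_pos hpos', M.log_div_eq hR.sampling_pos (hR.pos ξ hξ.1)]
    ring
  have hklu : M.kl q (ξ + u) ≠ ∞ := by
    rw [M.kl_ne_top_iff hpos']
    simp only [hlogeq]
    exact hv.sub hDi
  have hle : (M.kl q ξ).toReal ≤ (M.kl q (ξ + u)).toReal := by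
    rw [hξ.2]
    exact ENNReal.toReal_mono hklu (M.klStar_le hmem)
  rw [M.toReal_kl (hR.pos ξ hξ.1), M.toReal_kl hpos'] at hle
  simp only [hlogeq] at hle
  rw [integral_sub hv hDi] at hle
  linarith

variable {Ω : Type*} [MeasurableSpace Ω] {P : Measure Ω} [IsProbabilityMeasure P] {y : ℕ → Ω → Y}

/-- Laplace approximation in probability of the marginal likelihood: each dimension contributes
`-log n / 2`, and a prior that vanishes to degree `2 * h` at the projection contributes
`-h * log n`. -/
theorem isBigOInProb_log_marginal (hmeas : ∀ i, Measurable (y i)) (hindep : iIndepFun y P)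
    (hlaw : ∀ i, P.map (y i) = q.toMeasure) (hR : M.IsRegularNonsingleton q)
    (hξ : M.IsKLProj q ξ) {π : EuclideanSpace ℝ (Fin d) → ℝ} (hπ : ∀ ξ ∈ M.Ξ, 0 ≤ π ξ)
    (hπi : IntegrableOn π M.Ξ) {h : ℕ} (hdeg : HasExactDegree π ξ (2 * h)) :
    IsBigOInProb P (fun n ω => Real.log (M.marginal π (fun i : Fin n => y i ω)) -
      ∑ i : Fin n, M.logLik (y i ω) ξ + ((d : ℝ) / 2 + h) * Real.log n) (fun _ => 1) := by
  obtain ⟨r₀, hr₀, hball₀, c, hc, hcb⟩ := hR.hessian_dominated ξ hξ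
  have hcb' : ∀ z, ∀ ξ' ∈ Metric.ball ξ r₀, ‖fderiv ℝ (fderiv ℝ (M.logLik z)) ξ'‖ ≤ c z := hcb
  have hneg : ∀ v, v ≠ 0 → ∫ z, fderiv ℝ (fderiv ℝ (M.logLik z)) ξ v v ∂q.toMeasure < 0 :=
    hR.hessian_negDef ξ hξ
  have hscore : IsBigOInProb P (fun n ω => ‖∑ i : Fin n, gradient (M.logLik (y i ω)) ξ‖)
      (fun n => Real.sqrt n) :=
    isBigOInProb_norm_sum (a := fun z => M.score z ξ) hmeas hindep hlaw (hR.memLp_score ξ hξ)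
      (integral_score_eq_zero hR hξ)
  obtain ⟨a, A, r, ha, hA, hr, hball, hquad⟩ := exists_quadratic_bounds (ℓ := M.logLik)
    hR.isOpen hR.contDiffOn hr₀ hball₀ hc hcb' hneg hmeas hindep hlaw hscore
  refine .of_forall_mem fun ε hε => ?_
  obtain ⟨C, G, hC, hG, hb⟩ := hquad ε hε
  have hΞ := hR.isOpen.measurableSet
  obtain ⟨K, S₁, hK, hS₁, hup⟩ := exists_laplace_upper_bound hΞ hr hball hπ hπi hdeg (C := C) ha
  obtain ⟨k, S₂, hk, hS₂, hlow⟩ := exists_laplace_lower_bound hΞ hr hball hπ hdeg hA hC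
  refine ⟨G, hG, |Real.log k| + |Real.log K| + 1, by positivity, ?_⟩
  have hsqrt : Tendsto (fun n : ℕ => Real.sqrt n) atTop atTop :=
    Real.tendsto_sqrt_atTop.comp tendsto_natCast_atTop_atTop
  filter_upwards [eventually_gt_atTop 0, hsqrt.eventually_ge_atTop S₁,
    hsqrt.eventually_ge_atTop S₂] with n hn hn1 hn2 ω hω
  have hn' : (0 : ℝ) < n := by exact_mod_cast hn
  set F : EuclideanSpace ℝ (Fin d) → ℝ := fun ξ' => ∑ i : Fin n, M.logLik (y i ω) ξ' with hF
  -- factoring out the likelihood at the projection leaves the integral bounded by Laplace's method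
  have hlik : ∀ ξ' ∈ M.Ξ, M.likelihood (fun i : Fin n => y i ω) ξ' * π ξ' =
      Real.exp (F ξ) * (Real.exp (F ξ' - F ξ) * π ξ') := by
    intro ξ' hξ'
    rw [likelihood_eq_exp hR.pos hξ', ← mul_assoc, ← Real.exp_add, add_sub_cancel]
  have hint : IntegrableOn (fun ξ' => Real.exp (F ξ' - F ξ) * π ξ') M.Ξ := by
    have h1 := (integrableOn_likelihood_mul hΞ hR.pos (fun z => (hR.contDiffOn z).continuousOn) hπi
      (fun i : Fin n => y i ω)).const_mul (Real.exp (-F ξ))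
    refine IntegrableOn.congr_fun h1 (fun ξ' hξ' => ?_) hΞ
    rw [hlik ξ' hξ', ← mul_assoc, ← Real.exp_add, neg_add_cancel, Real.exp_zero, one_mul]
  have hmarg : M.marginal π (fun i : Fin n => y i ω) =
      Real.exp (F ξ) * ∫ ξ' in M.Ξ, Real.exp (F ξ' - F ξ) * π ξ' := by
    rw [marginal, setIntegral_congr_fun hΞ hlik, integral_const_mul]
  have hconn : ∀ t, IsPreconnected {ξ' ∈ M.Ξ | t < F ξ'} := by
    intro t
    have h1 := hR.levelSets n hn (fun i : Fin n => y i ω) (t / n)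
    have h2 : ∀ ξ', (t / n < M.avgLogLik (fun i : Fin n => y i ω) ξ') ↔ t < F ξ' := fun ξ' => by
      rw [avgLogLik, div_lt_div_iff_of_pos_right hn']
    simpa only [h2] using h1
  have hU := hup _ hn1 F hconn (fun u hu => (hb n ω hω u hu).1) hint
  have hL := hlow _ hn2 F (fun u hu => (hb n ω hω u hu).2) hint
  rw [finrank_euclideanSpace_fin] at hU hL
  set I := ∫ ξ' in M.Ξ, Real.exp (F ξ' - F ξ) * π ξ' with hI
  have hs : 0 < Real.sqrt n ^ (d + 2 * h) := by positivity
  have hIpos : 0 < I := pos_of_mul_pos_right (hk.trans_le hL) hs.le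
  have hlog : Real.log (M.marginal π (fun i : Fin n => y i ω)) - F ξ +
      ((d : ℝ) / 2 + h) * Real.log n = Real.log (Real.sqrt n ^ (d + 2 * h) * I) := by
    rw [hmarg, Real.log_mul (Real.exp_ne_zero _) hIpos.ne', Real.log_exp,
      Real.log_mul hs.ne' hIpos.ne', Real.log_pow, Real.log_sqrt hn'.le]
    push_cast
    ring
  rw [hlog, mul_one, abs_le]
  have e1 := Real.log_le_log hk hL
  have e2 := Real.log_le_log (by positivity) hU
  have e3 := neg_abs_le (Real.log k)
  have e4 := le_abs_self (Real.log K)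
  constructor <;> linarith [abs_nonneg (Real.log k), abs_nonneg (Real.log K)]

omit [Countable Y] [MeasurableSpace Y] [DiscreteMeasurableSpace Y] in
theorem IsLocalPrior.hasExactDegree {p : EuclideanSpace ℝ (Fin d) → ℝ} (hp : M.IsLocalPrior p)
    (hopen : IsOpen M.Ξ) (hξ : ξ ∈ M.Ξ) : HasExactDegree p ξ 0 := by
  simpa using (hasExactDegree_one ξ).mul (hp.continuousOn.continuousAt (hopen.mem_nhds hξ))
    (hp.pos ξ hξ)

/-- Under a local prior the marginal likelihood is, up to a bounded factor, the likelihood at the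
projection times `n ^ (-d / 2)`, whether or not the model is a singleton. -/
theorem IsRegular.exists_isBigOInProb_log_marginal (hmeas : ∀ i, Measurable (y i))
    (hindep : iIndepFun y P) (hlaw : ∀ i, P.map (y i) = q.toMeasure) (hR : M.IsRegular q)
    {p : EuclideanSpace ℝ (Fin d) → ℝ} (hp : M.IsLocalPrior p) :
    (∀ z, 0 < q z) ∧ (∀ (n : ℕ) (z : Fin n → Y), 0 < M.marginal p z) ∧
    ∃ ξ, M.IsKLProj q ξ ∧ (∀ z, 0 < M.f ξ z) ∧
      MemLp (fun z => Real.log ((q z).toReal / (M.f ξ z).toReal)) 2 q.toMeasure ∧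
      IsBigOInProb P (fun n ω => Real.log (M.marginal p (fun i : Fin n => y i ω)) -
        ∑ i : Fin n, M.logLik (y i ω) ξ + (d : ℝ) / 2 * Real.log n) (fun _ => 1) := by
  rcases hR with ⟨rfl, hR⟩ | ⟨-, hR⟩
  · obtain ⟨ξ, hΞ⟩ := hR.exists_eq_singleton
    have hξ : ξ ∈ M.Ξ := by rw [hΞ]; exact Set.mem_singleton _
    have hmarg : ∀ (n : ℕ) (z : Fin n → Y), M.marginal p z = Real.exp (∑ i, M.logLik (z i) ξ) :=
      fun n z => marginal_eq_of_singleton hΞ hR.pos hp.integral_eq_one z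
    refine ⟨hR.sampling_pos, fun n z => by rw [hmarg]; exact Real.exp_pos _, ξ, ⟨hξ, ?_⟩,
      hR.pos ξ hξ, hR.variance_finite ξ hξ, ?_⟩
    · simp only [klStar, hΞ, Set.mem_singleton_iff, iInf_iInf_eq_left]
    · simp only [hmarg, Real.log_exp, sub_self, CharP.cast_eq_zero, zero_div, zero_mul, add_zero]
      exact isBigOInProb_of_abs_le (a := fun _ => 0) one_pos (.of_forall fun n => by simp)
  · obtain ⟨ξ, hξ, -⟩ := hR.existsUnique_proj
    refine ⟨hR.sampling_pos, fun n z => marginal_pos hR.isOpen.measurableSet hR.pos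
      (fun z => (hR.contDiffOn z).continuousOn) (fun ξ hξ => (hp.pos ξ hξ).le) hp.integrableOn
      (by rw [hp.integral_eq_one]; exact one_pos) z, ξ, hξ, hR.pos ξ hξ.1,
      hR.variance_finite ξ hξ, ?_⟩
    have h0 := isBigOInProb_log_marginal hmeas hindep hlaw hR hξ (fun ξ hξ => (hp.pos ξ hξ).le)
      hp.integrableOn (h := 0) (hp.hasExactDegree hR.isOpen hξ.1)
    simpa using h0

/-- Under a moment prior of order `h` at the projection, the marginal likelihood has an additional
factor `n ^ (-h)`. -/
theorem IsRegularMomentPrior.isBigOInProb_log_marginal (hmeas : ∀ i, Measurable (y i))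
    (hindep : iIndepFun y P) (hlaw : ∀ i, P.map (y i) = q.toMeasure)
    (hR : M.IsRegularNonsingleton q) (hξ : M.IsKLProj q ξ)
    {g p : EuclideanSpace ℝ (Fin d) → ℝ} (hprior : M.IsRegularMomentPrior g p) {h : ℕ}
    (hh : HasMomentOrder g ξ h) :
    (∀ (n : ℕ) (z : Fin n → Y), 0 < M.marginal (M.momentPrior g p) z) ∧
      IsBigOInProb P (fun n ω =>
        Real.log (M.marginal (M.momentPrior g p) (fun i : Fin n => y i ω)) -
        ∑ i : Fin n, M.logLik (y i ω) ξ + ((d : ℝ) / 2 + h) * Real.log n) (fun _ => 1) := by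
  have hp := hprior.isLocalPrior
  have hnn : ∀ ξ ∈ M.Ξ, 0 ≤ M.momentPrior g p ξ := fun ξ hξ =>
    div_nonneg (mul_nonneg (hprior.nonneg ξ hξ) (hp.pos ξ hξ).le) hprior.integral_pos.le
  have hi : IntegrableOn (M.momentPrior g p) M.Ξ := hprior.integrableOn.div_const _
  refine ⟨fun n z => marginal_pos hR.isOpen.measurableSet hR.pos
      (fun z => (hR.contDiffOn z).continuousOn) hnn hi ?_ z,
    StatModel.isBigOInProb_log_marginal hmeas hindep hlaw hR hξ hnn hi ?_⟩
  · simp only [momentPrior]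
    rw [integral_div]
    exact div_pos hprior.integral_pos hprior.integral_pos
  · have h1 := hasExactDegree_of_order hR.isOpen hprior.contDiffOn hprior.nonneg hξ.1 hh
    have h2 := h1.mul
      ((hp.continuousOn.continuousAt (hR.isOpen.mem_nhds hξ.1)).div_const
        (∫ ξ' in M.Ξ, g ξ' * p ξ'))
      (div_pos (hp.pos ξ hξ.1) hprior.integral_pos)
    have h3 : M.momentPrior g p = fun ξ' => g ξ' * (p ξ' / ∫ ξ' in M.Ξ, g ξ' * p ξ') := by
      funext ξ'
      rw [momentPrior, mul_div_assoc]
    rw [h3]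
    exact h2

/-- The projection of a member of the model is that member: its divergence is `0`. -/
theorem f_eq_of_isKLProj (hq : q ∈ M.dists) (hξ : M.IsKLProj q ξ) : M.f ξ = q := by
  obtain ⟨ξ', hξ', rfl⟩ := hq
  rw [← M.kl_eq_zero_iff, hξ.2]
  exact le_antisymm ((M.klStar_le hξ').trans_eq (M.kl_eq_zero_iff.2 rfl)) zero_le

end LaplaceApproximation

end StatModel

theorem mainTheorem2
    {Y : Type*} [Countable Y] [MeasurableSpace Y] [DiscreteMeasurableSpace Y]
    {d₀ d₁ : ℕ} (hd : d₀ < d₁)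
    (M₀ : StatModel Y d₀) (M₁ : StatModel Y d₁)
    (hnested : M₀.dists ⊆ M₁.dists)
    (hreg₀ : ∀ q ∈ M₁.dists, M₀.IsRegular q)
    (hreg₁ : ∀ q ∈ M₁.dists, M₁.IsRegular q)
    (p₀ : EuclideanSpace ℝ (Fin d₀) → ℝ) (hp₀ : M₀.IsLocalPrior p₀)
    (g p₁ : EuclideanSpace ℝ (Fin d₁) → ℝ) (hprior : M₁.IsRegularMomentPrior g p₁)
    (h : ℕ) (hh : ∀ ξ ∈ StatModel.nullSubspace M₀ M₁, StatModel.HasMomentOrder g ξ h)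
    {Ω : Type*} [MeasurableSpace Ω] (P : Measure Ω) [IsProbabilityMeasure P]
    (y : ℕ → Ω → Y) (hmeas : ∀ i, Measurable (y i)) (hindep : iIndepFun y P)
    (q : PMF Y) (hlaw : ∀ i, P.map (y i) = q.toMeasure) :
    (q ∈ M₁.dists \ M₀.dists →
      0 < M₀.klStar q ∧ M₀.klStar q < ∞ ∧
      ∃ R : ℕ → Ω → ℝ, IsBigOInProb P R (fun n => Real.sqrt n) ∧
        ∀ n ω,
          (StatModel.bayesFactor M₁ (M₁.momentPrior g p₁) M₀ p₀ (fun i : Fin n => y i ω))⁻¹ =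
            Real.exp (-(n * (M₀.klStar q).toReal) + R n ω)) ∧
    (q ∈ M₀.dists →
      (∃ R : ℕ → Ω → ℝ, IsBigOInProb P R (fun _ => 1) ∧
        ∀ n ω,
          StatModel.bayesFactor M₁ (M₁.momentPrior g p₁) M₀ p₀ (fun i : Fin n => y i ω) =
            Real.exp (-(((d₁ : ℝ) - d₀) / 2 + h) * Real.log n + R n ω)) ∧
      (∃ R : ℕ → Ω → ℝ, IsBigOInProb P R (fun _ => 1) ∧
        ∀ n ω,
          StatModel.bayesFactor M₁ (M₁.momentPrior g p₁) M₀ p₀ (fun i : Fin n => y i ω) =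
            StatModel.bayesFactor M₁ p₁ M₀ p₀ (fun i : Fin n => y i ω) *
              Real.exp (-h * Real.log n + R n ω))) := by
  have hpos₁ : 0 < d₁ := Nat.zero_lt_of_lt hd
  have hns : ∀ q ∈ M₁.dists, M₁.IsRegularNonsingleton q := fun q hq =>
    (hreg₁ q hq).elim (fun h => absurd h.1 hpos₁.ne') fun h => h.2
  -- positivity of the marginal likelihoods makes the Bayes factor a genuine exponential for every
  -- sample, so that the remainder can be defined by taking logarithms
  have hlogBF : ∀ (p p' : _) (n : ℕ) (z : Fin n → Y), 0 < M₁.marginal p z →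
      0 < M₀.marginal p' z → StatModel.bayesFactor M₁ p M₀ p' z =
        Real.exp (Real.log (M₁.marginal p z) - Real.log (M₀.marginal p' z)) :=
    fun p p' n z h1 h0 => by
      rw [Real.exp_sub, Real.exp_log h1, Real.exp_log h0, StatModel.bayesFactor]
  constructor
  · rintro ⟨hq₁, hq₀⟩
    obtain ⟨hqpos, hm₀, ξ₀, hξ₀, hf₀, hmem, hO₀⟩ :=
      (hreg₀ q hq₁).exists_isBigOInProb_log_marginal hmeas hindep hlaw hp₀
    have hR₁ := hns q hq₁
    obtain ⟨ξ₁, hξ₁, -⟩ := hR₁.existsUnique_proj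
    have hfq : M₁.f ξ₁ = q := StatModel.f_eq_of_isKLProj hq₁ hξ₁
    obtain ⟨h', hh'⟩ := hprior.exists_order ξ₁ hξ₁.1
    obtain ⟨hm₁, hO₁⟩ := hprior.isBigOInProb_log_marginal hmeas hindep hlaw hR₁ hξ₁ hh'
    have hfin : M₀.klStar q ≠ ∞ := by
      rw [← hξ₀.2, M₀.kl_ne_top_iff hf₀]
      exact hmem.integrable (by norm_num)
    -- the infimum is attained, and it can vanish only at a parameter whose density is `q`
    have hne : M₀.klStar q ≠ 0 := by
      rw [← hξ₀.2, Ne, M₀.kl_eq_zero_iff]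
      exact fun h => hq₀ ⟨ξ₀, hξ₀.1, h⟩
    refine ⟨pos_iff_ne_zero.2 hne, hfin.lt_top, fun n ω =>
      Real.log (M₀.marginal p₀ (fun i : Fin n => y i ω)) -
        Real.log (M₁.marginal (M₁.momentPrior g p₁) (fun i : Fin n => y i ω)) +
        n * (M₀.klStar q).toReal, ?_, fun n ω => ?_⟩
    · have hK : (M₀.klStar q).toReal =
          ∫ z, Real.log ((q z).toReal / (M₀.f ξ₀ z).toReal) ∂q.toMeasure := by
        rw [← hξ₀.2, M₀.toReal_kl hf₀]
      have hsum := isBigOInProb_sum_sub_mean hmeas hindep hlaw hmem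
      rw [← hK] at hsum
      have hsqrt1 : ∀ᶠ n : ℕ in atTop, (1 : ℝ) ≤ 1 * Real.sqrt n := by
        filter_upwards [eventually_ge_atTop 1] with n hn
        rw [one_mul, Real.one_le_sqrt]
        exact_mod_cast hn
      have hlog : IsBigOInProb P (fun n _ => (((d₁ : ℝ) / 2 + h') - (d₀ : ℝ) / 2) * Real.log n)
          (fun n => Real.sqrt n) := by
        refine isBigOInProb_of_abs_le
          (c := 2 * (|((d₁ : ℝ) / 2 + h') - (d₀ : ℝ) / 2| + 1)) (by positivity) ?_
        filter_upwards [eventually_ge_atTop 1] with n hn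
        have hn' : (1 : ℝ) ≤ n := by exact_mod_cast hn
        have h0 : 0 ≤ Real.log n := Real.log_nonneg hn'
        have h1 : Real.log n ≤ 2 * Real.sqrt n := by
          have h2 := Real.log_le_self (Real.sqrt_nonneg (n : ℝ))
          rw [Real.log_sqrt (by positivity)] at h2
          linarith
        rw [abs_mul, abs_of_nonneg h0]
        calc _ ≤ (|((d₁ : ℝ) / 2 + h') - (d₀ : ℝ) / 2| + 1) * (2 * Real.sqrt n) := by
              gcongr
              linarith
          _ = _ := by ring
      -- the remainder is the difference of the two bounded Laplace remainders, plus a logarithmic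
      -- term, minus the centred sum of the log-density ratios
      have hall := (((hO₀.sub hO₁).mono one_pos hsqrt1).add hlog).sub hsum
      convert! hall using 3 with n ω
      have h3 : ∑ i : Fin n, Real.log ((q (y i ω)).toReal / (M₀.f ξ₀ (y i ω)).toReal) =
          ∑ i : Fin n, M₁.logLik (y i ω) ξ₁ - ∑ i : Fin n, M₀.logLik (y i ω) ξ₀ := by
        rw [← Finset.sum_sub_distrib]
        refine Finset.sum_congr rfl fun i _ => ?_
        rw [M₀.log_div_eq hqpos hf₀, StatModel.logLik, StatModel.logLik, hfq]
      rw [h3]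
      ring
    · rw [hlogBF _ _ _ _ (hm₁ _ _) (hm₀ _ _), ← Real.exp_neg]
      congr 1
      ring
  · intro hq₀
    have hq₁ := hnested hq₀
    obtain ⟨hqpos, hm₀, ξ₀, hξ₀, hf₀, hmem, hO₀⟩ :=
      (hreg₀ q hq₁).exists_isBigOInProb_log_marginal hmeas hindep hlaw hp₀
    have hR₁ := hns q hq₁
    obtain ⟨ξ₁, hξ₁, -⟩ := hR₁.existsUnique_proj
    have hfq₁ : M₁.f ξ₁ = q := StatModel.f_eq_of_isKLProj hq₁ hξ₁
    have hfq₀ : M₀.f ξ₀ = q := StatModel.f_eq_of_isKLProj hq₀ hξ₀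
    obtain ⟨hm₁, hO₁⟩ := hprior.isBigOInProb_log_marginal hmeas hindep hlaw hR₁ hξ₁
      (hh ξ₁ ⟨hξ₁.1, by rw [hfq₁]; exact hq₀⟩)
    have hp₁ := hprior.isLocalPrior
    have hnn : ∀ ξ ∈ M₁.Ξ, 0 ≤ p₁ ξ := fun ξ hξ => (hp₁.pos ξ hξ).le
    have hL : ∀ (n : ℕ) (z : Fin n → Y), 0 < M₁.marginal p₁ z := fun n z =>
      StatModel.marginal_pos hR₁.isOpen.measurableSet hR₁.pos
        (fun z => (hR₁.contDiffOn z).continuousOn) hnn hp₁.integrableOn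
        (by rw [hp₁.integral_eq_one]; exact one_pos) z
    have hOL := StatModel.isBigOInProb_log_marginal hmeas hindep hlaw hR₁ hξ₁ hnn
      hp₁.integrableOn (h := 0) (hp₁.hasExactDegree hR₁.isOpen hξ₁.1)
    constructor
    · refine ⟨fun n ω =>
        Real.log (M₁.marginal (M₁.momentPrior g p₁) (fun i : Fin n => y i ω)) -
          Real.log (M₀.marginal p₀ (fun i : Fin n => y i ω)) +
          (((d₁ : ℝ) - d₀) / 2 + h) * Real.log n, ?_, fun n ω => ?_⟩
      -- both projections have density `q`, so the maximal log-likelihood terms cancel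
      · convert! hO₁.sub hO₀ using 3 with n ω
        simp only [StatModel.logLik, hfq₁, hfq₀]
        ring
      · rw [hlogBF _ _ _ _ (hm₁ _ _) (hm₀ _ _)]
        congr 1
        ring
    · refine ⟨fun n ω =>
        Real.log (M₁.marginal (M₁.momentPrior g p₁) (fun i : Fin n => y i ω)) -
          Real.log (M₁.marginal p₁ (fun i : Fin n => y i ω)) + h * Real.log n, ?_, fun n ω => ?_⟩
      · convert! hO₁.sub hOL using 3 with n ω
        push_cast
        ring
      · rw [hlogBF _ _ _ _ (hm₁ _ _) (hm₀ _ _), hlogBF _ _ _ _ (hL _ _) (hm₀ _ _),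
          ← Real.exp_add]
        congr 1
        ring
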